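/- Let $\mathcal{H}_A,\mathcal{H}_B$ be separable complex Hilbert spaces, $\mathfrak{T}(\mathcal{H})$ the space of trace class operators on $\mathcal{H}$ with the trace norm $\|T\|_1=\operatorname{Tr}|T|$, and $\mathfrak{S}(\mathcal{H})$ the set of states, i.e. positive operators of unit trace. For a positive trace class operator $A\neq0$ let $H(A)=[\operatorname{Tr}A]\,\operatorname{Tr}\eta(A/\operatorname{Tr}A)=\operatorname{Tr}\eta(A)-\eta(\operatorname{Tr}A)\in[0,+\infty]$ be the (homogeneously extended) von Neumann entropy, and $H(0)=0$, where $\eta(x)=-x\log x$ and $\eta(0)=0$. Let $\Phi:\mathfrak{T}(\mathcal{H}_A)\to\mathfrak{T}(\mathcal{H}_B)$ be a positive linear map and $H_\Phi(\rho)=H(\Phi(\rho))$. Suppose that $H_\Phi(\rho)\le C<+\infty$ for every pure state $\rho=|\varphi\rangle\langle\varphi|$, $\|\varphi\|=1$, of $\mathcal{H}_A$. (1) For every natural $k$ the function $H_\Phi$ is finite and uniformly continuous, with respect to the trace norm, on the set $\mathfrak{S}_k(\mathcal{H}_A)=\{\rho\in\mathfrak{S}(\mathcal{H}_A):\operatorname{rank}\rho\le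 k\}$. (2) If moreover $\Phi$ does not increase the trace of any positive operator, then for all states $\rho,\sigma\in\mathfrak{S}(\mathcal{H}_A)$ of finite rank, with $\varepsilon=\frac12\|\rho-\sigma\|_1$, $$|H_\Phi(\rho)-H_\Phi(\sigma)|\le\varepsilon\bigl(C+\log(\operatorname{rank}\rho+\operatorname{rank}\sigma-1)\bigr)+(1+\varepsilon)\,h_2\!\left(\frac{\varepsilon}{1+\varepsilon}\right),$$ where $h_2(p)=\eta(p)+\eta(1-p)$. -/

import Mathlib

open scoped ENNReal NNReal InnerProductSpace

noncomputable section

namespace OutputEntropy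

set_option linter.unusedSectionVars false

variable {H : Type*} [NormedAddCommGroup H] [InnerProductSpace ℂ H] [CompleteSpace H]

variable (H) in
/-- The index set of a fixed orthonormal basis of `H`. -/
def basisIndex : Set H := (exists_hilbertBasis ℂ H).choose

variable (H) in
/-- A fixed orthonormal basis of `H`. -/
def basis : HilbertBasis (basisIndex H) ℂ H := (exists_hilbertBasis ℂ H).choose_spec.choose

/-- The trace `∑ᵢ ⟨eᵢ, T eᵢ⟩ ∈ [0, ∞]` of a positive bounded operator `T`; it does not depend on the
orthonormal basis, see `posTrace_eq`. (It is only ever used for positive operators.) -/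
def posTrace (T : H →L[ℂ] H) : ℝ≥0∞ :=
  ∑' i, ENNReal.ofReal (RCLike.re ⟪basis H i, T (basis H i)⟫_ℂ)

/-- The trace norm `‖T‖₁ = Tr |T| ∈ [0, ∞]`, with `|T| = √(T* T)`. -/
def traceNorm (T : H →L[ℂ] H) : ℝ≥0∞ := posTrace (CFC.abs T)

lemma parseval {ι : Type*} (b : HilbertBasis ι ℂ H) (x : H) :
    ∑' i, ENNReal.ofReal (‖⟪b i, x⟫_ℂ‖ ^ 2) = ENNReal.ofReal (‖x‖ ^ 2) := by
  have h := b.hasSum_inner_mul_inner x x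
  have h2 : HasSum (fun i => ‖⟪b i, x⟫_ℂ‖ ^ 2) (‖x‖ ^ 2) := by
    have h3 := Complex.hasSum_re h
    have e : (⟪x, x⟫_ℂ).re = ‖x‖ ^ 2 := by
      rw [← inner_self_eq_norm_sq (𝕜 := ℂ) x]; rfl
    rw [e] at h3
    refine h3.congr_fun ?_ |> fun h => h
    intro i
    rw [← inner_conj_symm x (b i), ← Complex.normSq_eq_conj_mul_self, Complex.ofReal_re,
      Complex.normSq_eq_norm_sq]
  rw [← ENNReal.ofReal_tsum_of_nonneg (fun i => by positivity) h2.summable, h2.tsum_eq]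

/-- Squared Hilbert-Schmidt norms of an operator and of its adjoint agree in any two bases. -/
lemma hs_adjoint {ι κ : Type*} (b : HilbertBasis ι ℂ H) (c : HilbertBasis κ ℂ H)
    (X : H →L[ℂ] H) :
    ∑' i, ENNReal.ofReal (‖X (b i)‖ ^ 2) = ∑' j, ENNReal.ofReal (‖(star X) (c j)‖ ^ 2) := by
  simp_rw [← parseval c (X _), ← parseval b ((star X) _)]
  rw [ENNReal.tsum_comm]
  refine tsum_congr fun j => tsum_congr fun i => ?_
  rw [ContinuousLinearMap.star_eq_adjoint, ContinuousLinearMap.adjoint_inner_right,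
    ← inner_conj_symm, RCLike.norm_conj]

lemma re_inner_eq_sqrt {T : H →L[ℂ] H} (hT : 0 ≤ T) (x : H) :
    RCLike.re ⟪x, T x⟫_ℂ = ‖CFC.sqrt T x‖ ^ 2 := by
  have h : CFC.sqrt T * CFC.sqrt T = T := CFC.sqrt_mul_sqrt_self T hT
  have hs : star (CFC.sqrt T) = CFC.sqrt T := (CFC.sqrt_nonneg T).isSelfAdjoint
  conv_lhs => rw [← h]
  rw [mul_apply_eq_comp, ← ContinuousLinearMap.adjoint_inner_left,
    ← ContinuousLinearMap.star_eq_adjoint, hs, inner_self_eq_norm_sq]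

/-- The trace of a positive operator can be computed in any orthonormal basis. -/
lemma posTrace_eq {ι : Type*} (b : HilbertBasis ι ℂ H) {T : H →L[ℂ] H} (hT : 0 ≤ T) :
    posTrace T = ∑' i, ENNReal.ofReal (RCLike.re ⟪b i, T (b i)⟫_ℂ) := by
  have hs : star (CFC.sqrt T) = CFC.sqrt T := (CFC.sqrt_nonneg T).isSelfAdjoint
  simp only [posTrace, re_inner_eq_sqrt hT]
  rw [hs_adjoint (basis H) b, hs]

/-- An approximate polar decomposition. -/
lemma exists_approx_polar (T : H →L[ℂ] H) {δ : ℝ} (hδ : 0 < δ) :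
    ∃ V : H →L[ℂ] H, ‖V‖ ≤ 1 ∧ ‖star V * T - CFC.abs T‖ ≤ δ ∧ ‖T - V * CFC.abs T‖ ≤ δ := by
  set a := CFC.abs T with ha
  have ha0 : 0 ≤ a := CFC.abs_nonneg T
  have hsa : IsSelfAdjoint a := ha0.isSelfAdjoint
  have haa : star T * T = a * a := (CFC.abs_mul_abs T).symm
  have hpos : ∀ x : ℝ, 0 < |x| + δ := fun x => by positivity
  have hc : Continuous fun x : ℝ => (|x| + δ)⁻¹ :=
    Continuous.inv₀ (by fun_prop) fun x => (hpos x).ne'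
  set w := cfc (fun x : ℝ => (|x| + δ)⁻¹) a with hw
  have hws : star w = w := (cfc_predicate (fun x : ℝ => (|x| + δ)⁻¹) a).star_eq
  have hid : a = cfc (fun x : ℝ => x) a := (cfc_id' ℝ a).symm
  have hx0 : ∀ x ∈ spectrum ℝ a, 0 ≤ x := fun x hx => spectrum_nonneg_of_nonneg ha0 hx
  have hwa : w * (a * a) = cfc (fun x : ℝ => (|x| + δ)⁻¹ * (x * x)) a := by
    rw [cfc_mul _ _ a hc.continuousOn (by fun_prop), cfc_mul _ _ a (by fun_prop) (by fun_prop),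
      ← hid]
  have hwaw : w * (a * a) * w
      = cfc (fun x : ℝ => (|x| + δ)⁻¹ * (x * x) * (|x| + δ)⁻¹) a := by
    rw [hwa, hw, ← cfc_mul (fun x : ℝ => (|x| + δ)⁻¹ * (x * x)) (fun x : ℝ => (|x| + δ)⁻¹) a
      (hc.continuousOn.mul (by fun_prop)) hc.continuousOn]
  refine ⟨T * w, ?_, ?_, ?_⟩
  · have h : ‖star (T * w) * (T * w)‖ ≤ 1 := by
      have : star (T * w) * (T * w) = w * (a * a) * w := by
        rw [star_mul, hws, ← haa]; noncomm_ring
      rw [this, hwaw]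
      refine norm_cfc_le zero_le_one fun x hx => ?_
      have := hx0 x hx
      have h1 := hpos x
      rw [Real.norm_of_nonneg (by positivity), abs_of_nonneg this]
      rw [abs_of_nonneg this] at h1
      rw [← div_eq_mul_inv, inv_mul_eq_div, div_div, div_le_one (by positivity)]
      nlinarith
    rw [CStarRing.norm_star_mul_self] at h
    nlinarith [norm_nonneg (T * w)]
  · have : star (T * w) * T - a = cfc (fun x : ℝ => (|x| + δ)⁻¹ * (x * x) - x) a := by
      rw [star_mul, hws, mul_assoc, haa, hwa,
        cfc_sub (fun x : ℝ => (|x| + δ)⁻¹ * (x * x)) (fun x : ℝ => x) a (by fun_prop) (by fun_prop),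
        ← hid]
    rw [this]
    refine norm_cfc_le hδ.le fun x hx => ?_
    have := hx0 x hx
    have h1 := hpos x
    rw [abs_of_nonneg this] at h1 ⊢
    have e : (x + δ)⁻¹ * (x * x) - x = -(x * δ / (x + δ)) := by field_simp; ring
    rw [e, norm_neg, Real.norm_of_nonneg (by positivity), div_le_iff₀ h1]
    nlinarith
  · set r := 1 - w * a with hr
    have hre : r = cfc (fun x : ℝ => 1 - (|x| + δ)⁻¹ * x) a := by
      rw [cfc_sub (fun _ : ℝ => 1) (fun x : ℝ => (|x| + δ)⁻¹ * x) a (by fun_prop) (by fun_prop),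
        cfc_mul _ _ a hc.continuousOn (by fun_prop), ← hid, cfc_const_one ℝ a]
    have hrs : star r = r := by
      rw [hre]; exact (cfc_predicate (fun x : ℝ => 1 - (|x| + δ)⁻¹ * x) a).star_eq
    have hc2 : Continuous fun x : ℝ => 1 - (|x| + δ)⁻¹ * x := by fun_prop
    have hE : T - T * w * a = T * r := by rw [hr]; noncomm_ring
    have h : ‖star (T * r) * (T * r)‖ ≤ δ * δ := by
      have : star (T * r) * (T * r)
          = cfc (fun x : ℝ => (1 - (|x| + δ)⁻¹ * x) * (x * x) * (1 - (|x| + δ)⁻¹ * x)) a := by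
        rw [cfc_mul _ _ a (by fun_prop) (by fun_prop), cfc_mul _ _ a (by fun_prop) (by fun_prop),
          cfc_mul _ _ a (by fun_prop) (by fun_prop), ← hre, ← hid, star_mul, hrs, ← haa]
        noncomm_ring
      rw [this]
      refine norm_cfc_le (by positivity) fun x hx => ?_
      have := hx0 x hx
      have h1 := hpos x
      rw [abs_of_nonneg this] at h1 ⊢
      have e : (1 - (x + δ)⁻¹ * x) * (x * x) * (1 - (x + δ)⁻¹ * x)
          = (x * δ / (x + δ)) * (x * δ / (x + δ)) := by field_simp; ring
      have e2 : x * δ / (x + δ) ≤ δ := by rw [div_le_iff₀ h1]; nlinarith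
      have e3 : 0 ≤ x * δ / (x + δ) := by positivity
      rw [e, Real.norm_of_nonneg (by positivity)]
      exact mul_le_mul e2 e2 e3 hδ.le
    rw [hE]
    rw [CStarRing.norm_star_mul_self] at h
    nlinarith [norm_nonneg (T * r)]

/-- If `∑ f ≤ A + δ N` for every `δ > 0` then `∑ f ≤ A`, with `A` in `[0, ∞]`. -/
lemma le_of_forall_slack {x N : ℝ} {A : ℝ≥0∞} (hN : 0 ≤ N)
    (h : ∀ δ : ℝ, 0 < δ → ENNReal.ofReal x ≤ A + ENNReal.ofReal (δ * N)) :
    ENNReal.ofReal x ≤ A := by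
  refine ENNReal.le_of_forall_pos_le_add fun ε hε _ => ?_
  refine (h (ε / (N + 1)) (by positivity)).trans (add_le_add le_rfl ?_)
  rw [← ENNReal.ofReal_coe_nnreal]
  refine ENNReal.ofReal_le_ofReal ?_
  rw [div_mul_eq_mul_div, div_le_iff₀ (by positivity)]
  have : (0 : ℝ) < ε := hε
  nlinarith

/-- `∑ᵢ |⟨W eᵢ, S eᵢ⟩| ≤ Tr |S|` for a contraction `W`. -/
lemma sum_norm_inner_le (S W : H →L[ℂ] H) (hW : ‖W‖ ≤ 1) (F : Finset (basisIndex H)) :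
    ENNReal.ofReal (∑ i ∈ F, ‖⟪W (basis H i), S (basis H i)⟫_ℂ‖) ≤ traceNorm S := by
  refine le_of_forall_slack (N := F.card) (by positivity) fun δ hδ => ?_
  obtain ⟨V, hV, -, hSV⟩ := exists_approx_polar S hδ
  have ha0 : 0 ≤ CFC.abs S := CFC.abs_nonneg S
  set q := CFC.sqrt (CFC.abs S) with hq
  have hqs : star q = q := (CFC.sqrt_nonneg (CFC.abs S)).isSelfAdjoint
  have hqq : q * q = CFC.abs S := CFC.sqrt_mul_sqrt_self _ ha0
  set Y := q * (star V * W) with hY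
  have hZ : ‖star (star V * W)‖ ≤ 1 := by
    rw [norm_star]
    refine (norm_mul_le _ _).trans ?_
    rw [norm_star]
    nlinarith [norm_nonneg V, norm_nonneg W]
  have htr : ∑' i, ENNReal.ofReal (‖q (basis H i)‖ ^ 2) = traceNorm S := by
    simp only [traceNorm, posTrace, re_inner_eq_sqrt ha0, hq]
  have hYtr : ∑' i, ENNReal.ofReal (‖Y (basis H i)‖ ^ 2) ≤ traceNorm S := by
    rw [hs_adjoint (basis H) (basis H), ← htr, hY, star_mul, hqs]
    refine ENNReal.tsum_le_tsum fun i => ENNReal.ofReal_le_ofReal ?_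
    rw [mul_apply_eq_comp]
    gcongr
    exact ((star (star V * W)).le_of_opNorm_le hZ _).trans (one_mul _).le
  have hnorm : ∀ i, ‖basis H i‖ = 1 := fun i => (basis H).orthonormal.1 i
  have key : ∀ i, ‖⟪W (basis H i), S (basis H i)⟫_ℂ‖
      ≤ (‖Y (basis H i)‖ ^ 2 + ‖q (basis H i)‖ ^ 2) / 2 + δ := by
    intro i
    have e1 : S (basis H i)
        = (V * CFC.abs S) (basis H i) + (S - V * CFC.abs S) (basis H i) := by simp
    have e2 : ⟪W (basis H i), (V * CFC.abs S) (basis H i)⟫_ℂ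
        = ⟪Y (basis H i), q (basis H i)⟫_ℂ := by
      rw [← hqq, hY]
      simp only [mul_apply_eq_comp]
      rw [← ContinuousLinearMap.adjoint_inner_left, ← ContinuousLinearMap.adjoint_inner_left,
        ← ContinuousLinearMap.star_eq_adjoint, ← ContinuousLinearMap.star_eq_adjoint, hqs]
    have e3 : ‖⟪W (basis H i), (S - V * CFC.abs S) (basis H i)⟫_ℂ‖ ≤ δ := by
      refine (norm_inner_le_norm _ _).trans ?_
      have h1 := W.le_of_opNorm_le hW (basis H i)
      have h2 := (S - V * CFC.abs S).le_of_opNorm_le hSV (basis H i)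
      rw [hnorm, mul_one] at h1 h2
      calc _ ≤ 1 * δ := mul_le_mul h1 h2 (norm_nonneg _) zero_le_one
        _ = δ := one_mul δ
    have e4 := norm_inner_le_norm (𝕜 := ℂ) (Y (basis H i)) (q (basis H i))
    rw [e1, inner_add_right, e2]
    refine (norm_add_le _ _).trans ?_
    nlinarith [sq_nonneg (‖Y (basis H i)‖ - ‖q (basis H i)‖)]
  have hsum : ∑ i ∈ F, ‖⟪W (basis H i), S (basis H i)⟫_ℂ‖
      ≤ 2⁻¹ * ∑ i ∈ F, ‖Y (basis H i)‖ ^ 2 + 2⁻¹ * ∑ i ∈ F, ‖q (basis H i)‖ ^ 2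
        + δ * F.card := by
    refine (Finset.sum_le_sum fun i _ => key i).trans (le_of_eq ?_)
    rw [Finset.sum_add_distrib, ← Finset.sum_div, Finset.sum_add_distrib, Finset.sum_const,
      nsmul_eq_mul]
    ring
  refine (ENNReal.ofReal_le_ofReal hsum).trans ?_
  rw [ENNReal.ofReal_add (by positivity) (by positivity),
    ENNReal.ofReal_add (by positivity) (by positivity),
    ENNReal.ofReal_mul (by positivity), ENNReal.ofReal_mul (by positivity),
    ENNReal.ofReal_sum_of_nonneg (fun _ _ => by positivity),
    ENNReal.ofReal_sum_of_nonneg (fun _ _ => by positivity)]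
  have b1 := (ENNReal.sum_le_tsum F).trans hYtr
  have b2 := (ENNReal.sum_le_tsum F).trans htr.le
  have b3 : ENNReal.ofReal 2⁻¹ = 2⁻¹ := by
    rw [ENNReal.ofReal_inv_of_pos two_pos, ENNReal.ofReal_ofNat]
  calc _ ≤ 2⁻¹ * traceNorm S + 2⁻¹ * traceNorm S + ENNReal.ofReal (δ * F.card) := by
        rw [b3]; gcongr
    _ = _ := by rw [← add_mul, ENNReal.inv_two_add_inv_two, one_mul]

/-- The triangle inequality for the trace norm. -/
lemma traceNorm_add_le (S T : H →L[ℂ] H) : traceNorm (S + T) ≤ traceNorm S + traceNorm T := by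
  rw [traceNorm, posTrace, ENNReal.tsum_eq_iSup_sum]
  refine iSup_le fun F => ?_
  have habs : 0 ≤ CFC.abs (S + T) := CFC.abs_nonneg (S + T)
  have hnn : ∀ i, 0 ≤ RCLike.re ⟪basis H i, CFC.abs (S + T) (basis H i)⟫_ℂ := fun i => by
    rw [re_inner_eq_sqrt habs]; exact sq_nonneg _
  rw [← ENNReal.ofReal_sum_of_nonneg fun i _ => hnn i]
  refine le_of_forall_slack (N := F.card) (by positivity) fun δ hδ => ?_
  obtain ⟨V, hV, hVA, -⟩ := exists_approx_polar (S + T) hδ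
  have hnorm : ∀ i, ‖basis H i‖ = 1 := fun i => (basis H).orthonormal.1 i
  have key : ∀ i, RCLike.re ⟪basis H i, CFC.abs (S + T) (basis H i)⟫_ℂ
      ≤ ‖⟪V (basis H i), S (basis H i)⟫_ℂ‖ + ‖⟪V (basis H i), T (basis H i)⟫_ℂ‖ + δ := by
    intro i
    set D := star V * (S + T) - CFC.abs (S + T) with hD
    have e1 : CFC.abs (S + T) (basis H i) = (star V * (S + T)) (basis H i) - D (basis H i) := by
      simp [hD]
    have e2 : ⟪basis H i, (star V * (S + T)) (basis H i)⟫_ℂ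
        = ⟪V (basis H i), S (basis H i)⟫_ℂ + ⟪V (basis H i), T (basis H i)⟫_ℂ := by
      rw [mul_apply_eq_comp, ContinuousLinearMap.star_eq_adjoint,
        ContinuousLinearMap.adjoint_inner_right, add_apply, inner_add_right]
    have e3 : ‖⟪basis H i, D (basis H i)⟫_ℂ‖ ≤ δ := by
      refine (norm_inner_le_norm _ _).trans ?_
      have h2 := D.le_of_opNorm_le hVA (basis H i)
      rw [hnorm, mul_one] at h2
      rwa [hnorm, one_mul]
    refine (RCLike.re_le_norm _).trans ?_
    rw [e1, inner_sub_right, e2]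
    exact (norm_sub_le _ _).trans (add_le_add (norm_add_le _ _) e3)
  have hsum := Finset.sum_le_sum fun i (_ : i ∈ F) => key i
  rw [Finset.sum_add_distrib, Finset.sum_add_distrib, Finset.sum_const, nsmul_eq_mul,
    mul_comm] at hsum
  refine (ENNReal.ofReal_le_ofReal hsum).trans ?_
  rw [ENNReal.ofReal_add (by positivity) (by positivity),
    ENNReal.ofReal_add (by positivity) (by positivity)]
  gcongr
  · exact sum_norm_inner_le S V hV F
  · exact sum_norm_inner_le T V hV F

lemma traceNorm_zero : traceNorm (0 : H →L[ℂ] H) = 0 := by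
  simp [traceNorm, posTrace]

lemma traceNorm_smul (c : ℂ) (T : H →L[ℂ] H) :
    traceNorm (c • T) = ENNReal.ofReal ‖c‖ * traceNorm T := by
  simp only [traceNorm, posTrace, CFC.abs_smul, ← ENNReal.tsum_mul_left]
  refine tsum_congr fun i => ?_
  rw [← ENNReal.ofReal_mul (norm_nonneg c)]
  congr 1
  rw [smul_apply, inner_smul_right_eq_smul, RCLike.smul_re]

variable (H) in
/-- The space of trace class operators on `H`: the bounded operators with finite trace norm. -/
def TraceClass : Submodule ℂ (H →L[ℂ] H) where
  carrier := {T | traceNorm T < ∞}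
  zero_mem' := by simp [traceNorm_zero]
  add_mem' {S T} hS hT := (traceNorm_add_le S T).trans_lt (ENNReal.add_lt_top.2 ⟨hS, hT⟩)
  smul_mem' c T hT := by
    change traceNorm (c • T) < ∞
    rw [traceNorm_smul]
    exact ENNReal.mul_lt_top ENNReal.ofReal_lt_top hT

/-- A quantum state: a positive operator of unit trace. -/
def IsState (ρ : TraceClass H) : Prop :=
  0 ≤ (ρ : H →L[ℂ] H) ∧ posTrace (ρ : H →L[ℂ] H) = 1

/-- A pure state: the rank one projection `|φ⟩⟨φ|` on a unit vector `φ`. -/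
def IsPure (ρ : TraceClass H) : Prop :=
  ∃ φ : H, ‖φ‖ = 1 ∧ (ρ : H →L[ℂ] H) = InnerProductSpace.rankOne ℂ φ φ

/-- The rank of an operator, as a cardinal. -/
def opRank (ρ : TraceClass H) : Cardinal := LinearMap.rank ((ρ : H →L[ℂ] H) : H →ₗ[ℂ] H)

variable (H) in
/-- The set of states of rank at most `k`. -/
def statesOfRankLE (k : ℕ) : Set (TraceClass H) := {ρ | IsState ρ ∧ opRank ρ ≤ k}

/-- The homogeneous extension `[Tr A] Tr η(A / Tr A) ∈ [0, ∞]` of the von Neumann entropy to the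
cone of positive trace class operators, where `η(x) = - x log x` and `η(A / Tr A)` is given by the
continuous functional calculus. It is `0` at `A = 0`. -/
def entropy (A : TraceClass H) : ℝ≥0∞ :=
  posTrace (A : H →L[ℂ] H) *
    posTrace (cfc Real.negMulLog
      ((posTrace (A : H →L[ℂ] H)).toReal⁻¹ • (A : H →L[ℂ] H)))

variable {K : Type*} [NormedAddCommGroup K] [InnerProductSpace ℂ K] [CompleteSpace K]

/-- A linear map between spaces of trace class operators is positive if it maps positive operators
to positive operators. -/
def IsPositiveMap (Φ : TraceClass H →ₗ[ℂ] TraceClass K) : Prop :=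
  ∀ A : TraceClass H, 0 ≤ (A : H →L[ℂ] H) → 0 ≤ (Φ A : K →L[ℂ] K)

/-- `Φ` does not increase the trace of any positive operator. -/
def IsTraceNonincreasing (Φ : TraceClass H →ₗ[ℂ] TraceClass K) : Prop :=
  ∀ A : TraceClass H, 0 ≤ (A : H →L[ℂ] H) →
    posTrace (Φ A : K →L[ℂ] K) ≤ posTrace (A : H →L[ℂ] H)

/-- The output entropy `H_Φ(ρ) = H(Φ(ρ))`. -/
def outputEntropy (Φ : TraceClass H →ₗ[ℂ] TraceClass K) (ρ : TraceClass H) : ℝ≥0∞ :=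
  entropy (Φ ρ)

/-- The quantity `ε = ½ ‖ρ - σ‖₁`, as a real number. -/
def traceDist (ρ σ : TraceClass H) : ℝ :=
  (traceNorm ((ρ - σ : TraceClass H) : H →L[ℂ] H)).toReal / 2

end OutputEntropy

end

noncomputable section

namespace OutputEntropy

set_option linter.unusedSectionVars false

variable {H : Type*} [NormedAddCommGroup H] [InnerProductSpace ℂ H] [CompleteSpace H]

/-! Let `ρ - σ = P - N` be the Jordan decomposition, so that `ρ + N = σ + P` and `Tr P = Tr N = ε`.
The homogeneous entropy is superadditive, and it is subadditive up to the classical entropy of the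
traces. Applying both to the images under `Φ` gives H(Φρ) ≤ H(Φρ) + H(ΦN) ≤ H(Φσ + ΦP) ≤ H(Φσ) +
H(ΦP) + (binary entropy term). It remains to bound H(ΦP) and the binary term.

Orthogonality of `P` and `N` forces `rank P ≤ rank ρ` (`exists_finset_of_orthogonal`). Hence `P` is
a finite positive combination of pure states, and subadditivity over its spectral decomposition
bounds H(ΦP) by `ε (C + M log rank ρ)`, where `M` bounds the output trace on pure states
(`entropy_map_le`). The binary term is at most `M (1 + ε) h₂(ε / (1 + ε))` (`relEta_pair_le`).
Exchanging `ρ` and `σ` gives a two-sided estimate.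

For a trace-nonincreasing map `M = 1`, and both ranks are at most their sum minus one, which is (2).
In general a finite `M` exists because positivity alone bounds `Φ` on pure states
(`IsPositiveMap.exists_tr_le`). The estimate then depends only on `ε`, `k`, `C` and `M`, and
vanishes as `ε → 0`, which is (1).

The two entropy inequalities come from scalar tangent-line bounds in eigenbases. Superadditivity is
Peierls' inequality plus the log-sum inequality. Subadditivity is `-Tr A log C ≤ -Tr A log A` for `A
≤ C`. Sums are kept in `[0, ∞]`, so they can be rearranged freely and infinite entropies need no
separate treatment. -/

/-! ### Functional calculus on eigenvectors and diagonalization -/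

/-- The continuous functional calculus acts on eigenvectors through the eigenvalue. -/
lemma cfc_apply_eigenvector {A : H →L[ℂ] H} (hA : IsSelfAdjoint A) {f : ℝ → ℝ} (hf : Continuous f)
    {l : ℝ} {x : H} (hx : A x = (l : ℂ) • x) : cfc f A x = (f l : ℂ) • x := by
  -- The interval contains both the spectrum and `l`, so a single polynomial approximates `f` on
  -- both and `l` need not be shown to lie in the spectrum.
  set R := max ‖A‖ |l| with hR
  have hmem : ∀ y ∈ spectrum ℝ A, y ∈ Set.Icc (-R) R := fun y hy => by
    have h1 : ‖y‖ ≤ ‖A‖ * ‖(1 : H →L[ℂ] H)‖ := spectrum.norm_le_norm_mul_of_mem hy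
    have h2 : ‖(1 : H →L[ℂ] H)‖ ≤ 1 := ContinuousLinearMap.norm_id_le
    have h3 : |y| ≤ ‖A‖ := by
      rw [← Real.norm_eq_abs]
      nlinarith [norm_nonneg A]
    exact abs_le.1 (h3.trans (le_max_left _ _))
  have hl : l ∈ Set.Icc (-R) R := abs_le.1 (le_max_right _ _)
  rw [← sub_eq_zero, ← norm_le_zero_iff]
  refine le_of_forall_pos_le_add fun ε hε => ?_
  obtain ⟨p, hp⟩ := exists_polynomial_near_of_continuousOn (-R) R f hf.continuousOn
    (ε / (2 * (‖x‖ + 1))) (by positivity)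
  set d := ε / (2 * (‖x‖ + 1)) with hd
  have hpA : Polynomial.aeval A p x = ((p.eval l : ℝ) : ℂ) • x := by
    have hpow : ∀ n : ℕ, (A ^ n) x = ((l ^ n : ℝ) : ℂ) • x := fun n => by
      induction n with
      | zero => simp
      | succ n ih =>
        rw [pow_succ, mul_apply_eq_comp, hx, map_smul, ih, smul_smul, pow_succ]
        push_cast
        rw [mul_comm]
    rw [Polynomial.aeval_eq_sum_range, Polynomial.eval_eq_sum_range, sum_apply,
      Complex.ofReal_sum, Finset.sum_smul]
    refine Finset.sum_congr rfl fun n _ => ?_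
    rw [smul_apply, hpow, ← Complex.coe_smul, smul_smul, Complex.ofReal_mul]
  have h1 : ‖cfc f A - Polynomial.aeval A p‖ ≤ d := by
    rw [← cfc_polynomial p A hA, ← cfc_sub f _ A (by fun_prop) (by fun_prop)]
    refine norm_cfc_le (by positivity) fun y hy => ?_
    have := hp y (hmem y hy)
    rw [abs_sub_comm] at this
    exact this.le
  have h2 : cfc f A x - (f l : ℂ) • x
      = (cfc f A - Polynomial.aeval A p) x + ((p.eval l - f l : ℝ) : ℂ) • x := by
    rw [sub_apply, hpA]; push_cast; module
  rw [h2, zero_add]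
  have h3 := (cfc f A - Polynomial.aeval A p).le_of_opNorm_le h1 x
  have h4 : ‖((p.eval l - f l : ℝ) : ℂ) • x‖ ≤ d * ‖x‖ := by
    rw [norm_smul, Complex.norm_real]
    exact mul_le_mul_of_nonneg_right (hp l hl).le (norm_nonneg _)
  have h5 : d * ‖x‖ + d * ‖x‖ ≤ ε := by
    rw [hd, ← two_mul, div_mul_eq_mul_div, ← mul_div_assoc, div_le_iff₀ (by positivity)]
    nlinarith [norm_nonneg x]
  exact (norm_add_le _ _).trans ((add_le_add h3 h4).trans h5)

lemma hasSum_norm_inner_sq {ι : Type*} (b : HilbertBasis ι ℂ H) (x : H) :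
    HasSum (fun i => ‖⟪b i, x⟫_ℂ‖ ^ 2) (‖x‖ ^ 2) := by
  have h3 := Complex.hasSum_re (b.hasSum_inner_mul_inner x x)
  have e : (⟪x, x⟫_ℂ).re = ‖x‖ ^ 2 := by
    rw [← inner_self_eq_norm_sq (𝕜 := ℂ) x]; rfl
  rw [e] at h3
  convert h3 using 2 with i
  rw [← inner_conj_symm x (b i), ← Complex.normSq_eq_conj_mul_self, Complex.ofReal_re,
    Complex.normSq_eq_norm_sq]

/-- The quadratic form is a weighted combination of eigenvalues, with weights summing to one for a
unit vector. This turns the operator inequalities into scalar convexity arguments. -/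
lemma hasSum_eigenvalue_mul {ι : Type*} (b : HilbertBasis ι ℂ H) {T : H →L[ℂ] H}
    (hT : IsSelfAdjoint T) {l : ι → ℝ} (hl : ∀ i, T (b i) = (l i : ℂ) • b i) (x : H) :
    HasSum (fun i => l i * ‖⟪b i, x⟫_ℂ‖ ^ 2) (RCLike.re ⟪x, T x⟫_ℂ) := by
  have h3 := Complex.hasSum_re (b.hasSum_inner_mul_inner x (T x))
  rw [show RCLike.re ⟪x, T x⟫_ℂ = (⟪x, T x⟫_ℂ).re from rfl]
  convert h3 using 2 with i
  have hs : T.adjoint = T := hT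
  have : ⟪b i, T x⟫_ℂ = l i * ⟪b i, x⟫_ℂ := by
    rw [← ContinuousLinearMap.adjoint_inner_left, hs, hl, inner_smul_left, Complex.conj_ofReal]
  rw [this, ← inner_conj_symm x (b i), mul_left_comm, ← Complex.normSq_eq_conj_mul_self,
    ← Complex.ofReal_mul, Complex.ofReal_re, Complex.normSq_eq_norm_sq]

lemma nonneg_of_eigenvalues {ι : Type*} (b : HilbertBasis ι ℂ H) {T : H →L[ℂ] H}
    (hT : IsSelfAdjoint T) {l : ι → ℝ} (h0 : ∀ i, 0 ≤ l i)
    (hl : ∀ i, T (b i) = (l i : ℂ) • b i) : 0 ≤ T := by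
  rw [ContinuousLinearMap.nonneg_iff_isPositive, ContinuousLinearMap.isPositive_def']
  refine ⟨hT, fun x => ?_⟩
  rw [ContinuousLinearMap.reApplyInnerSelf_apply, inner_re_symm]
  exact (hasSum_eigenvalue_mul b hT hl x).nonneg fun i => mul_nonneg (h0 i) (by positivity)

/-- A bounded operator with summable squared norms on an orthonormal basis is compact. -/
lemma isCompactOperator_of_hilbertSchmidt {ι : Type*} (b : HilbertBasis ι ℂ H) {S : H →L[ℂ] H}
    (hS : Summable fun i => ‖S (b i)‖ ^ 2) : IsCompactOperator S := by
  set F : Finset ι → H →L[ℂ] H := fun s => ∑ i ∈ s, InnerProductSpace.rankOne ℂ (S (b i)) (b i)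
    with hF
  have hcomp : ∀ s, IsCompactOperator (F s) := fun s => by
    refine Submodule.sum_mem (compactOperator (RingHom.id ℂ) H H) (t := s)
      (f := fun i => InnerProductSpace.rankOne ℂ (S (b i)) (b i)) fun i _ => ?_
    change IsCompactOperator (InnerProductSpace.rankOne ℂ (S (b i)) (b i))
    rw [InnerProductSpace.rankOne_def']
    have h1 : IsCompactOperator (ContinuousLinearMap.toSpanSingleton ℂ (S (b i))) :=
      isCompactOperator_of_locallyCompactSpace_rng _
    exact h1.comp_clm (innerSL ℂ (b i))
  refine isCompactOperator_of_tendsto (l := Filter.atTop) (F := F) ?_ (.of_forall hcomp)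
  rw [tendsto_iff_norm_sub_tendsto_zero]
  set t := ∑' i, ‖S (b i)‖ ^ 2 with ht
  -- Cauchy–Schwarz bounds the operator norm of the remainder by its Hilbert–Schmidt norm, which is
  -- the square root of the tail of a convergent series.
  have hbound : ∀ s, ‖F s - S‖ ≤ √(t - ∑ i ∈ s, ‖S (b i)‖ ^ 2) := by
    intro s
    refine ContinuousLinearMap.opNorm_le_bound _ (Real.sqrt_nonneg _) fun x => ?_
    have hsum : HasSum (fun i => ⟪b i, x⟫_ℂ • S (b i)) (S x) := by
      have := (b.hasSum_repr x).mapL S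
      simpa [HilbertBasis.repr_apply_apply] using this
    have hFs : F s x = ∑ i ∈ s, ⟪b i, x⟫_ℂ • S (b i) := by simp [hF, sum_apply]
    have htend : Filter.Tendsto
        (fun u : Finset ι => ‖F s x - ∑ i ∈ u, ⟪b i, x⟫_ℂ • S (b i)‖) Filter.atTop
        (nhds ‖(F s - S) x‖) := by
      rw [sub_apply]
      exact (tendsto_const_nhds.sub hsum).norm
    refine le_of_tendsto htend ?_
    filter_upwards [Filter.eventually_ge_atTop s] with u hu
    classical
    rw [hFs, ← Finset.sum_sdiff hu, norm_sub_rev, add_sub_cancel_right]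
    have c1 : ‖∑ i ∈ u \ s, ⟪b i, x⟫_ℂ • S (b i)‖ ≤ ∑ i ∈ u \ s, ‖S (b i)‖ * ‖⟪b i, x⟫_ℂ‖ := by
      refine (norm_sum_le _ _).trans (Finset.sum_le_sum fun i _ => ?_)
      rw [norm_smul, mul_comm]
    refine c1.trans ((Real.sum_mul_le_sqrt_mul_sqrt _ _ _).trans ?_)
    have c2 : ∑ i ∈ u \ s, ‖S (b i)‖ ^ 2 ≤ t - ∑ i ∈ s, ‖S (b i)‖ ^ 2 := by
      have := hS.sum_le_tsum u fun i _ => by positivity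
      rw [← Finset.sum_sdiff hu] at this
      linarith
    have c3 : ∑ i ∈ u \ s, ‖⟪b i, x⟫_ℂ‖ ^ 2 ≤ ‖x‖ ^ 2 :=
      sum_le_hasSum _ (fun i _ => by positivity) (hasSum_norm_inner_sq b x)
    refine mul_le_mul (Real.sqrt_le_sqrt c2) ?_ (Real.sqrt_nonneg _) (Real.sqrt_nonneg _)
    rw [← Real.sqrt_sq (norm_nonneg x)]
    exact Real.sqrt_le_sqrt c3
  refine squeeze_zero (fun s => norm_nonneg _) hbound ?_
  have := ((tendsto_const_nhds (x := t)).sub hS.hasSum).sqrt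
  simpa [ht] using this

/-- A positive operator of finite trace is compact. -/
lemma isCompactOperator_of_posTrace_ne_top {T : H →L[ℂ] H} (hT : 0 ≤ T) (ht : posTrace T ≠ ∞) :
    IsCompactOperator T := by
  have h : Summable fun i => ‖CFC.sqrt T (basis H i)‖ ^ 2 := by
    simp only [posTrace, re_inner_eq_sqrt hT] at ht
    refine (ENNReal.summable_toReal ht).congr fun i => ?_
    rw [ENNReal.toReal_ofReal (by positivity)]
  have h2 := (isCompactOperator_of_hilbertSchmidt _ h).comp_clm (CFC.sqrt T)
  have h3 : CFC.sqrt T * CFC.sqrt T = T := CFC.sqrt_mul_sqrt_self T hT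
  rw [← h3]
  exact h2

/-- A positive operator of finite trace is diagonal in some orthonormal basis. -/
lemma exists_eigenbasis.{u} {H : Type u} [NormedAddCommGroup H] [InnerProductSpace ℂ H]
    [CompleteSpace H] {T : H →L[ℂ] H} (hT : 0 ≤ T) (ht : posTrace T ≠ ∞) :
    ∃ (ι : Type u) (b : HilbertBasis ι ℂ H) (l : ι → ℝ),
      (∀ i, 0 ≤ l i) ∧ ∀ i, T (b i) = (l i : ℂ) • b i := by
  have hpos := (ContinuousLinearMap.nonneg_iff_isPositive T).1 hT
  have hsym := hpos.isSymmetric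
  have hbot := ContinuousLinearMap.orthogonalComplement_iSup_eigenspaces_eq_bot
    (isCompactOperator_of_posTrace_ne_top hT ht) hsym
  have hcl : ∀ μ : ℂ, CompleteSpace (Module.End.eigenspace (T : Module.End ℂ H) μ) := fun μ => by
    have : IsClosed (Module.End.eigenspace (T : Module.End ℂ H) μ : Set H) := by
      have e : (Module.End.eigenspace (T : Module.End ℂ H) μ : Set H) = {x | T x = μ • x} := by
        ext x; simp
      rw [e]
      exact isClosed_eq T.continuous (continuous_const_smul μ)
    exact this.completeSpace_coe
  -- Glue orthonormal bases of all the eigenspaces, the kernel included. Compactness makes the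
  -- eigenspaces total, so the glued family is a Hilbert basis.
  set v : (Σ μ : ℂ, basisIndex (Module.End.eigenspace (T : Module.End ℂ H) μ)) → H :=
    fun a => (basis (Module.End.eigenspace (T : Module.End ℂ H) a.1) a.2 : H) with hv
  have hon : Orthonormal ℂ v :=
    hsym.orthogonalFamily_eigenspaces.orthonormal_sigma_orthonormal
      fun μ => (basis (Module.End.eigenspace (T : Module.End ℂ H) μ)).orthonormal
  have hsp : (Submodule.span ℂ (Set.range v))ᗮ = ⊥ := by
    rw [eq_bot_iff, ← hbot]
    intro x hx
    rw [← Submodule.iInf_orthogonal, Submodule.mem_iInf]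
    intro μ
    rw [Submodule.mem_orthogonal']
    intro y hy
    have h := ((basis (Module.End.eigenspace (T : Module.End ℂ H) μ)).hasSum_repr ⟨y, hy⟩).mapL
      ((innerSL ℂ x) ∘L (Module.End.eigenspace (T : Module.End ℂ H) μ).subtypeL)
    refine h.unique (hasSum_zero.congr_fun fun i => ?_)
    have hi : ⟪x, v ⟨μ, i⟩⟫_ℂ = 0 :=
      (Submodule.mem_orthogonal' _ _).1 hx _ (Submodule.subset_span ⟨_, rfl⟩)
    simp only [hv] at hi
    simp [hi]
  have hev : ∀ a, T (v a) = a.1 • v a := fun a =>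
    Module.End.mem_eigenspace_iff.1 (basis (Module.End.eigenspace (T : Module.End ℂ H) a.1) a.2).2
  have hnorm : ∀ a, ‖v a‖ = 1 := hon.1
  have hre : ∀ a : (Σ μ : ℂ, basisIndex (Module.End.eigenspace (T : Module.End ℂ H) μ)),
      0 ≤ a.1.re ∧ (a.1.re : ℂ) = a.1 := fun a => by
    have h := hpos.inner_nonneg_right (v a)
    rw [hev, inner_smul_right, inner_self_eq_norm_sq_to_K, hnorm] at h
    simp only [Complex.coe_algebraMap, Complex.ofReal_one, one_pow, mul_one] at h
    exact ⟨(Complex.nonneg_iff.1 h).1, Complex.ext rfl (Complex.nonneg_iff.1 h).2⟩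
  refine ⟨_, HilbertBasis.mkOfOrthogonalEqBot hon hsp, fun a => a.1.re, fun a => (hre a).1,
    fun a => ?_⟩
  rw [HilbertBasis.coe_mkOfOrthogonalEqBot, (hre a).2, hev]

/-! ### Trace and entropy in terms of eigenvalues -/

lemma re_inner_nonneg {T : H →L[ℂ] H} (hT : 0 ≤ T) (x : H) : 0 ≤ RCLike.re ⟪x, T x⟫_ℂ := by
  rw [re_inner_eq_sqrt hT]; positivity

lemma re_inner_eigen {ι : Type*} (b : HilbertBasis ι ℂ H) {T : H →L[ℂ] H} {i : ι} {l : ℝ}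
    (h : T (b i) = (l : ℂ) • b i) : RCLike.re ⟪b i, T (b i)⟫_ℂ = l := by
  rw [h, inner_smul_right, inner_self_eq_norm_sq_to_K, b.orthonormal.1 i]
  simp

lemma posTrace_eq_tsum {ι : Type*} (b : HilbertBasis ι ℂ H) {T : H →L[ℂ] H} (hT : 0 ≤ T)
    {l : ι → ℝ} (hl : ∀ i, T (b i) = (l i : ℂ) • b i) :
    posTrace T = ∑' i, ENNReal.ofReal (l i) := by
  rw [posTrace_eq b hT]
  exact tsum_congr fun i => by rw [re_inner_eigen b (hl i)]

lemma posTrace_add {S T : H →L[ℂ] H} (hS : 0 ≤ S) (hT : 0 ≤ T) :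
    posTrace (S + T) = posTrace S + posTrace T := by
  rw [posTrace, posTrace, posTrace, ← ENNReal.tsum_add]
  refine tsum_congr fun i => ?_
  rw [← ENNReal.ofReal_add (re_inner_nonneg hS _) (re_inner_nonneg hT _), add_apply,
    inner_add_right, map_add]

lemma posTrace_smul {c : ℝ} (hc : 0 ≤ c) (T : H →L[ℂ] H) :
    posTrace (c • T) = ENNReal.ofReal c * posTrace T := by
  rw [posTrace, posTrace, ← ENNReal.tsum_mul_left]
  refine tsum_congr fun i => ?_
  rw [← ENNReal.ofReal_mul hc, smul_apply, ← Complex.coe_smul, inner_smul_right,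
    ← RCLike.re_ofReal_mul]
  rfl

lemma posTrace_mono {S T : H →L[ℂ] H} (h : S ≤ T) : posTrace S ≤ posTrace T := by
  refine ENNReal.tsum_le_tsum fun i => ENNReal.ofReal_le_ofReal ?_
  have := re_inner_nonneg (sub_nonneg.2 h) (basis H i)
  rw [sub_apply, inner_sub_right, map_sub] at this
  linarith

lemma traceNorm_of_nonneg {T : H →L[ℂ] H} (hT : 0 ≤ T) : traceNorm T = posTrace T := by
  rw [traceNorm, CFC.abs_of_nonneg T hT]

lemma posTrace_ne_top (A : TraceClass H) (hA : 0 ≤ (A : H →L[ℂ] H)) :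
    posTrace (A : H →L[ℂ] H) ≠ ∞ := by
  rw [← traceNorm_of_nonneg hA]
  exact A.2.ne

/-- The real trace of a positive trace class operator. -/
def tr (A : TraceClass H) : ℝ := (posTrace (A : H →L[ℂ] H)).toReal

lemma tr_nonneg (A : TraceClass H) : 0 ≤ tr A := ENNReal.toReal_nonneg

lemma eigenvalue_le_tr {ι : Type*} (b : HilbertBasis ι ℂ H) {A : TraceClass H}
    (hA : 0 ≤ (A : H →L[ℂ] H)) {l : ι → ℝ} (hl : ∀ i, (A : H →L[ℂ] H) (b i) = (l i : ℂ) • b i)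
    (i : ι) : l i ≤ tr A := by
  have h := posTrace_eq_tsum b hA hl
  rw [tr, ← ENNReal.ofReal_le_iff_le_toReal (posTrace_ne_top A hA), h]
  exact ENNReal.le_tsum (f := fun i => ENNReal.ofReal (l i)) i

/-- The entropy of a positive trace class operator in terms of its eigenvalues. -/
lemma entropy_eq_tsum {ι : Type*} (b : HilbertBasis ι ℂ H) {A : TraceClass H}
    (hA : 0 ≤ (A : H →L[ℂ] H)) {l : ι → ℝ} (h0 : ∀ i, 0 ≤ l i)
    (hl : ∀ i, (A : H →L[ℂ] H) (b i) = (l i : ℂ) • b i) :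
    entropy A = ∑' i, ENNReal.ofReal (l i * (Real.log (tr A) - Real.log (l i))) := by
  have hle := eigenvalue_le_tr b hA hl
  have hof : posTrace (A : H →L[ℂ] H) = ENNReal.ofReal (tr A) :=
    (ENNReal.ofReal_toReal (posTrace_ne_top A hA)).symm
  rcases (tr_nonneg A).eq_or_lt with ht | ht
  -- With zero trace all eigenvalues vanish, so both sides are zero.
  · have : ∀ i, l i = 0 := fun i => le_antisymm (ht ▸ hle i) (h0 i)
    simp [entropy, hof, ← ht, this]
  set t := tr A with htdef
  have hB : 0 ≤ t⁻¹ • (A : H →L[ℂ] H) := smul_nonneg (by positivity) hA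
  have hBl : ∀ i, (t⁻¹ • (A : H →L[ℂ] H)) (b i) = ((t⁻¹ * l i : ℝ) : ℂ) • b i := fun i => by
    rw [smul_apply, hl, ← Complex.coe_smul, smul_smul]; push_cast; rfl
  have hcl := fun i => cfc_apply_eigenvector hB.isSelfAdjoint Real.continuous_negMulLog (hBl i)
  -- The trace is basis independent only for positive operators. Here positivity holds because the
  -- normalized eigenvalues lie in `[0, 1]`.
  have hcpos : 0 ≤ cfc Real.negMulLog (t⁻¹ • (A : H →L[ℂ] H)) := by
    refine nonneg_of_eigenvalues b (cfc_predicate _ _) (fun i => ?_) hcl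
    refine Real.negMulLog_nonneg (mul_nonneg (by positivity) (h0 i)) ?_
    rw [inv_mul_le_one₀ ht]
    exact hle i
  rw [entropy, hof, ENNReal.toReal_ofReal ht.le, posTrace_eq_tsum b hcpos hcl,
    ← ENNReal.tsum_mul_left]
  refine tsum_congr fun i => ?_
  rw [← ENNReal.ofReal_mul ht.le]
  congr 1
  rcases (h0 i).eq_or_lt with h | h
  · simp [← h]
  · rw [Real.negMulLog, Real.log_mul (by positivity) h.ne', Real.log_inv]
    field_simp
    ring

/-! ### The scalar entropy function -/

/-- The function `x ↦ x log (t / x)`, vanishing at `x = 0`. -/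
def relEta (t x : ℝ) : ℝ := x * (Real.log t - Real.log x)

lemma relEta_zero (t : ℝ) : relEta t 0 = 0 := by simp [relEta]

lemma log_sub_log_nonneg {t x : ℝ} (hx : 0 < x) (hxt : x ≤ t) : 0 ≤ Real.log t - Real.log x :=
  sub_nonneg.2 (Real.log_le_log hx hxt)

lemma relEta_nonneg {t x : ℝ} (hx : 0 ≤ x) (hxt : x ≤ t) : 0 ≤ relEta t x := by
  rcases hx.eq_or_lt with h | h
  · simp [relEta, ← h]
  · exact mul_nonneg hx (log_sub_log_nonneg h hxt)

/-- The tangent line bound `x log (y / x) ≤ y - x`. -/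
lemma mul_log_sub_log_le {x y : ℝ} (hx : 0 ≤ x) (hy : 0 < y) :
    x * (Real.log y - Real.log x) ≤ y - x := by
  rcases hx.eq_or_lt with h | h
  · simp [← h, hy.le]
  · have h1 := Real.log_le_sub_one_of_pos (div_pos hy h)
    rw [Real.log_div hy.ne' h.ne'] at h1
    have h2 := mul_le_mul_of_nonneg_left h1 hx
    rwa [mul_sub_one, mul_div_cancel₀ _ h.ne'] at h2

/-- Tangent-line majorants have explicit real sums; this carries them over to sums in `[0, ∞]`. -/
lemma tsum_ofReal_le_of_hasSum {ι : Type*} {f g : ι → ℝ} {S : ℝ} (hf : ∀ i, 0 ≤ f i)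
    (hfg : ∀ i, f i ≤ g i) (hg : HasSum g S) : ∑' i, ENNReal.ofReal (f i) ≤ ENNReal.ofReal S := by
  refine (ENNReal.tsum_le_tsum fun i => ENNReal.ofReal_le_ofReal (hfg i)).trans ?_
  rw [← ENNReal.ofReal_tsum_of_nonneg (fun i => (hf i).trans (hfg i)) hg.summable, hg.tsum_eq]

lemma ofReal_tr {A : TraceClass H} (hA : 0 ≤ (A : H →L[ℂ] H)) :
    ENNReal.ofReal (tr A) = posTrace (A : H →L[ℂ] H) :=
  ENNReal.ofReal_toReal (posTrace_ne_top A hA)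

lemma re_inner_le_tr {ι : Type*} (b : HilbertBasis ι ℂ H) {A : TraceClass H}
    (hA : 0 ≤ (A : H →L[ℂ] H)) (i : ι) :
    RCLike.re ⟪b i, (A : H →L[ℂ] H) (b i)⟫_ℂ ≤ tr A := by
  rw [tr, ← ENNReal.ofReal_le_iff_le_toReal (posTrace_ne_top A hA), posTrace_eq b hA]
  exact ENNReal.le_tsum (f := fun i => ENNReal.ofReal (RCLike.re ⟪b i, (A : H →L[ℂ] H) (b i)⟫_ℂ)) i

lemma hasSum_norm_inner_sq_basis {ι : Type*} (b : HilbertBasis ι ℂ H) {x : H} (hx : ‖x‖ = 1) :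
    HasSum (fun i => ‖⟪b i, x⟫_ℂ‖ ^ 2) 1 := by
  simpa [hx] using hasSum_norm_inner_sq b x

/-! ### Peierls' inequality and monotonicity of the logarithm -/

/-- Peierls' inequality. -/
lemma tsum_relEta_eigenvalue_le {ι κ : Type*} (b : HilbertBasis ι ℂ H) (c : HilbertBasis κ ℂ H)
    {A : TraceClass H} (hA : 0 ≤ (A : H →L[ℂ] H)) {a : κ → ℝ} (h0 : ∀ j, 0 ≤ a j)
    (ha : ∀ j, (A : H →L[ℂ] H) (c j) = (a j : ℂ) • c j) {t : ℝ} (ht : tr A ≤ t) :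
    ∑' j, ENNReal.ofReal (relEta t (a j)) ≤
      ∑' i, ENNReal.ofReal (relEta t (RCLike.re ⟪b i, (A : H →L[ℂ] H) (b i)⟫_ℂ)) := by
  have hnn : ∀ j, 0 ≤ relEta t (a j) := fun j =>
    relEta_nonneg (h0 j) ((eigenvalue_le_tr c hA ha j).trans ht)
  -- Insert `∑ᵢ |⟨bᵢ, cⱼ⟩|² = 1` and exchange the sums. For fixed `i` what is left is Jensen's
  -- inequality for the concave function `relEta t`.
  have h1 : ∀ j, ENNReal.ofReal (relEta t (a j))
      = ∑' i, ENNReal.ofReal (‖⟪b i, c j⟫_ℂ‖ ^ 2 * relEta t (a j)) := fun j => by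
    have hs := hasSum_norm_inner_sq_basis b (c.orthonormal.1 j)
    simp_rw [ENNReal.ofReal_mul (sq_nonneg ‖⟪b _, c j⟫_ℂ‖)]
    rw [ENNReal.tsum_mul_right, ← ENNReal.ofReal_tsum_of_nonneg (fun i => by positivity)
      hs.summable, hs.tsum_eq, ENNReal.ofReal_one, one_mul]
  simp_rw [h1]
  rw [ENNReal.tsum_comm]
  refine ENNReal.tsum_le_tsum fun i => ?_
  have hw : HasSum (fun j => ‖⟪b i, c j⟫_ℂ‖ ^ 2) 1 := by
    simpa only [norm_inner_symm] using hasSum_norm_inner_sq_basis c (b.orthonormal.1 i)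
  have hα := hasSum_eigenvalue_mul c hA.isSelfAdjoint ha (b i)
  simp only [norm_inner_symm _ (b i)] at hα
  set α := RCLike.re ⟪b i, (A : H →L[ℂ] H) (b i)⟫_ℂ with hαdef
  have hα0 : 0 ≤ α := re_inner_nonneg hA (b i)
  rcases hα0.eq_or_lt with h | h
  · rw [← h, relEta_zero]
    refine tsum_ofReal_le_of_hasSum (g := fun _ => 0) (fun j => mul_nonneg (by positivity) (hnn j))
      (fun j => le_of_eq ?_) hasSum_zero
    have := (hasSum_zero_iff_of_nonneg fun j => mul_nonneg (h0 j) (by positivity)).1 (h ▸ hα)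
    have := congrFun this j
    simp only [Pi.zero_apply] at this
    rw [relEta, ← mul_assoc, mul_comm (_ ^ 2), this, zero_mul]
  · have hS := ((hα.mul_right (Real.log t - Real.log α)).add (hw.mul_right α)).sub hα
    rw [one_mul, add_sub_cancel_right] at hS
    refine tsum_ofReal_le_of_hasSum (fun j => mul_nonneg (by positivity) (hnn j)) (fun j => ?_) hS
    have := mul_le_mul_of_nonneg_left (mul_log_sub_log_le (h0 j) h) (sq_nonneg ‖⟪b i, c j⟫_ℂ‖)
    rw [relEta]
    nlinarith

/-- If `C` dominates `a |f⟩⟨f|` then `a ⟨f, C⁻¹ f⟩ ≤ 1`, on finite sums. -/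
lemma sum_div_eigenvalue_le_one {ι : Type*} (b : HilbertBasis ι ℂ H) {C : H →L[ℂ] H}
    {l : ι → ℝ} (h0 : ∀ i, 0 ≤ l i) (hl : ∀ i, C (b i) = (l i : ℂ) • b i) {f : H} {a : ℝ}
    (hf : ∀ x, a * ‖⟪f, x⟫_ℂ‖ ^ 2 ≤ RCLike.re ⟪x, C x⟫_ℂ) (F : Finset ι) :
    ∑ i ∈ F, a * (‖⟪b i, f⟫_ℂ‖ ^ 2 / l i) ≤ 1 := by
  set s := ∑ i ∈ F, ‖⟪b i, f⟫_ℂ‖ ^ 2 / l i with hs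
  have hs0 : 0 ≤ s := Finset.sum_nonneg fun i _ => div_nonneg (by positivity) (h0 i)
  -- The test vector is `C⁻¹ f` truncated to `F`, with kernel directions dropped because division by
  -- zero gives zero. Both `⟨f, x⟩` and `⟨x, C x⟩` equal `s`, so the hypothesis reads `a s² ≤ s`.
  set x : H := ∑ i ∈ F, (⟪b i, f⟫_ℂ / l i) • b i with hx
  have h1 : ⟪f, x⟫_ℂ = s := by
    rw [hx, inner_sum, hs, Complex.ofReal_sum]
    refine Finset.sum_congr rfl fun i _ => ?_
    rw [inner_smul_right, ← inner_conj_symm f (b i), div_mul_eq_mul_div, Complex.mul_conj,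
      Complex.normSq_eq_norm_sq]
    push_cast; rfl
  have h2 : RCLike.re ⟪x, C x⟫_ℂ = s := by
    have hCx : C x = ∑ i ∈ F, (if l i = 0 then 0 else ⟪b i, f⟫_ℂ) • b i := by
      rw [hx, map_sum]
      refine Finset.sum_congr rfl fun i _ => ?_
      rw [map_smul, hl, smul_smul]
      split_ifs with h
      · simp [h]
      · rw [div_mul_cancel₀ _ (Complex.ofReal_ne_zero.2 h)]
    rw [hCx, hx, b.orthonormal.inner_sum, map_sum, hs]
    refine Finset.sum_congr rfl fun i _ => ?_
    split_ifs with h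
    · simp [h]
    · rw [map_div₀, Complex.conj_ofReal, div_mul_eq_mul_div, mul_comm, Complex.mul_conj,
        Complex.normSq_eq_norm_sq, ← Complex.ofReal_div]
      rfl
  have h3 := hf x
  rw [h1, h2, Complex.norm_real, Real.norm_of_nonneg hs0] at h3
  rw [← Finset.mul_sum, ← hs]
  rcases hs0.eq_or_lt with h | h
  · rw [← h]; simp
  · nlinarith

/-- Monotonicity of the logarithm, in the form `-Tr A log C ≤ -Tr A log A` for `A ≤ C`. -/
lemma tsum_mul_log_le_of_le {ι κ : Type*} (b : HilbertBasis ι ℂ H) (c : HilbertBasis κ ℂ H)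
    {A C : TraceClass H} (hA : 0 ≤ (A : H →L[ℂ] H)) (hAC : (A : H →L[ℂ] H) ≤ C)
    {a : κ → ℝ} (h0 : ∀ j, 0 ≤ a j)
    (ha : ∀ j, (A : H →L[ℂ] H) (c j) = (a j : ℂ) • c j)
    {l : ι → ℝ} (hl0 : ∀ i, 0 ≤ l i)
    (hl : ∀ i, (C : H →L[ℂ] H) (b i) = (l i : ℂ) • b i) {t : ℝ} (ht : tr C ≤ t) :
    ∑' i, ENNReal.ofReal (RCLike.re ⟪b i, (A : H →L[ℂ] H) (b i)⟫_ℂ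
        * (Real.log t - Real.log (l i))) ≤ ∑' j, ENNReal.ofReal (relEta t (a j)) := by
  have hC : 0 ≤ (C : H →L[ℂ] H) := hA.trans hAC
  have hlt : ∀ i, l i ≤ t := fun i => (eigenvalue_le_tr b hC hl i).trans ht
  have hα : ∀ i, HasSum (fun j => a j * ‖⟪b i, c j⟫_ℂ‖ ^ 2)
      (RCLike.re ⟪b i, (A : H →L[ℂ] H) (b i)⟫_ℂ) := fun i => by
    simpa only [norm_inner_symm _ (b i)] using
      hasSum_eigenvalue_mul c hA.isSelfAdjoint ha (b i)
  have hdom : ∀ j x, a j * ‖⟪c j, x⟫_ℂ‖ ^ 2 ≤ RCLike.re ⟪x, (C : H →L[ℂ] H) x⟫_ℂ := fun j x => by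
    have h1 := le_hasSum (hasSum_eigenvalue_mul c hA.isSelfAdjoint ha x) j
      fun j _ => mul_nonneg (h0 j) (by positivity)
    have h2 := re_inner_nonneg (sub_nonneg.2 hAC) x
    rw [sub_apply, inner_sub_right, map_sub] at h2
    linarith
  -- The kernel of `C` is invisible to `A`, so the default value `log 0 = 0` does no harm.
  have hzero : ∀ i j, l i = 0 → a j * ‖⟪b i, c j⟫_ℂ‖ ^ 2 = 0 := fun i j h => by
    have h1 := hdom j (b i)
    rw [re_inner_eigen b (hl i), h, norm_inner_symm] at h1
    exact le_antisymm h1 (mul_nonneg (h0 j) (by positivity))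
  have hterm : ∀ i j, 0 ≤ a j * ‖⟪b i, c j⟫_ℂ‖ ^ 2 * (Real.log t - Real.log (l i)) := fun i j => by
    rcases (hl0 i).eq_or_lt with h | h
    · rw [hzero i j h.symm, zero_mul]
    · exact mul_nonneg (mul_nonneg (h0 j) (by positivity)) (log_sub_log_nonneg h (hlt i))
  have h1 : ∀ i, ENNReal.ofReal (RCLike.re ⟪b i, (A : H →L[ℂ] H) (b i)⟫_ℂ
      * (Real.log t - Real.log (l i)))
      = ∑' j, ENNReal.ofReal (a j * ‖⟪b i, c j⟫_ℂ‖ ^ 2 * (Real.log t - Real.log (l i))) :=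
    fun i => by
      have := (hα i).mul_right (Real.log t - Real.log (l i))
      rw [← ENNReal.ofReal_tsum_of_nonneg (hterm i) this.summable, this.tsum_eq]
  simp_rw [h1]
  rw [ENNReal.tsum_comm]
  refine ENNReal.tsum_le_tsum fun j => ?_
  rcases (h0 j).eq_or_lt with h | h
  · simp [← h]
  have hF := sum_div_eigenvalue_le_one b hl0 hl (hdom j)
  have hnn : ∀ i, 0 ≤ a j * (‖⟪b i, c j⟫_ℂ‖ ^ 2 / l i) := fun i =>
    mul_nonneg (h0 j) (div_nonneg (by positivity) (hl0 i))
  have hsum : Summable fun i => a j * (‖⟪b i, c j⟫_ℂ‖ ^ 2 / l i) :=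
    summable_of_sum_le hnn hF
  have hle1 : ∑' i, a j * (‖⟪b i, c j⟫_ℂ‖ ^ 2 / l i) ≤ 1 := hsum.tsum_le_of_sum_le hF
  have hw := hasSum_norm_inner_sq_basis b (c.orthonormal.1 j)
  -- Use `log (aⱼ / lᵢ) ≤ aⱼ / lᵢ - 1` with weights `|⟨bᵢ, cⱼ⟩|²`. The total of the terms `aⱼ |⟨bᵢ,
  -- cⱼ⟩|² / lᵢ` is at most one, so it is absorbed by the `-1`.
  have hS := ((hw.mul_right (Real.log t - Real.log (a j) - 1)).add hsum.hasSum).mul_left (a j)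
  refine (tsum_ofReal_le_of_hasSum (fun i => hterm i j) (fun i => ?_) hS).trans
    (ENNReal.ofReal_le_ofReal ?_)
  · rw [mul_assoc]
    refine mul_le_mul_of_nonneg_left ?_ (h0 j)
    rcases (hl0 i).eq_or_lt with hi | hi
    · have := (mul_eq_zero.1 (hzero i j hi.symm)).resolve_left h.ne'
      rw [this]; simp
    · have h3 := Real.log_le_sub_one_of_pos (div_pos h hi)
      rw [Real.log_div h.ne' hi.ne'] at h3
      have h4 := mul_le_mul_of_nonneg_left h3 (sq_nonneg ‖⟪b i, c j⟫_ℂ‖)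
      have h5 : a j * (‖⟪b i, c j⟫_ℂ‖ ^ 2 / l i) = ‖⟪b i, c j⟫_ℂ‖ ^ 2 * (a j / l i) := by ring
      rw [h5]
      linarith
  · rw [relEta]
    refine mul_le_mul_of_nonneg_left ?_ (h0 j)
    linarith

/-! ### Subadditivity and superadditivity of the entropy -/

lemma coe_sum_traceClass {κ : Type*} (s : Finset κ) (A : κ → TraceClass H) :
    ((∑ k ∈ s, A k : TraceClass H) : H →L[ℂ] H) = ∑ k ∈ s, (A k : H →L[ℂ] H) := by
  simp

lemma tr_add {A B : TraceClass H} (hA : 0 ≤ (A : H →L[ℂ] H)) (hB : 0 ≤ (B : H →L[ℂ] H)) :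
    tr (A + B) = tr A + tr B := by
  rw [tr, Submodule.coe_add, posTrace_add hA hB,
    ENNReal.toReal_add (posTrace_ne_top A hA) (posTrace_ne_top B hB)]
  rfl

lemma tr_zero : tr (0 : TraceClass H) = 0 := by simp [tr, posTrace]

lemma tr_sum {κ : Type*} (s : Finset κ) {A : κ → TraceClass H}
    (hA : ∀ k ∈ s, 0 ≤ (A k : H →L[ℂ] H)) : tr (∑ k ∈ s, A k) = ∑ k ∈ s, tr (A k) := by
  classical
  induction s using Finset.induction_on with
  | empty => simp [tr_zero]
  | insert k s hk ih =>
    have h1 : ∀ j ∈ s, 0 ≤ (A j : H →L[ℂ] H) := fun j hj => hA j (Finset.mem_insert_of_mem hj)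
    rw [Finset.sum_insert hk, Finset.sum_insert hk, tr_add (hA k (Finset.mem_insert_self k s)),
      ih h1]
    rw [coe_sum_traceClass]
    exact Finset.sum_nonneg h1

/-- The sum `∑ⱼ aⱼ log (t / aⱼ)` over the eigenvalues, for `t` above the trace. -/
lemma tsum_relEta_eq_entropy_add {κ : Type*} (c : HilbertBasis κ ℂ H)
    {A : TraceClass H} (hA : 0 ≤ (A : H →L[ℂ] H)) {a : κ → ℝ} (h0 : ∀ j, 0 ≤ a j)
    (ha : ∀ j, (A : H →L[ℂ] H) (c j) = (a j : ℂ) • c j) {t : ℝ} (ht : tr A ≤ t) :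
    ∑' j, ENNReal.ofReal (relEta t (a j)) = entropy A + ENNReal.ofReal (relEta t (tr A)) := by
  have hle := eigenvalue_le_tr c hA ha
  rcases (tr_nonneg A).eq_or_lt with h | h
  · have : ∀ j, a j = 0 := fun j => le_antisymm (h ▸ hle j) (h0 j)
    simp [entropy_eq_tsum c hA h0 ha, this, ← h, relEta]
  -- Split `log (t / aⱼ)` as `log (tr A / aⱼ) + log (t / tr A)`; both parts are nonnegative, so the
  -- sums separate.
  have hd := log_sub_log_nonneg h ht
  rw [entropy_eq_tsum c hA h0 ha, relEta, ENNReal.ofReal_mul h.le, ofReal_tr hA,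
    posTrace_eq_tsum c hA ha, ← ENNReal.tsum_mul_right, ← ENNReal.tsum_add]
  refine tsum_congr fun j => ?_
  have hj := relEta_nonneg (h0 j) (hle j)
  rw [relEta] at hj
  rw [← ENNReal.ofReal_mul (h0 j), ← ENNReal.ofReal_add hj (mul_nonneg (h0 j) hd), relEta]
  congr 1
  ring

/-- Subadditivity of the entropy up to the classical entropy of the traces. -/
lemma entropy_sum_le {κ : Type*} (s : Finset κ) {A : κ → TraceClass H}
    (hA : ∀ k ∈ s, 0 ≤ (A k : H →L[ℂ] H)) :
    entropy (∑ k ∈ s, A k) ≤ ∑ k ∈ s,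
      (entropy (A k) + ENNReal.ofReal (relEta (∑ j ∈ s, tr (A j)) (tr (A k)))) := by
  rw [← tr_sum s hA]
  set C := ∑ k ∈ s, A k with hCdef
  have hC : 0 ≤ (C : H →L[ℂ] H) := by
    rw [hCdef, coe_sum_traceClass]; exact Finset.sum_nonneg hA
  have hle : ∀ k ∈ s, (A k : H →L[ℂ] H) ≤ C := fun k hk => by
    rw [hCdef, coe_sum_traceClass]; exact Finset.single_le_sum hA hk
  have htle : ∀ k ∈ s, tr (A k) ≤ tr C := fun k hk => by
    rw [hCdef, tr_sum s hA]
    exact Finset.single_le_sum (fun j _ => tr_nonneg (A j)) hk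
  obtain ⟨ι, b, l, hl0, hl⟩ := exists_eigenbasis hC (posTrace_ne_top C hC)
  have hlC := eigenvalue_le_tr b hC hl
  have hsum : ∀ i, l i = ∑ k ∈ s, RCLike.re ⟪b i, (A k : H →L[ℂ] H) (b i)⟫_ℂ := fun i => by
    rw [← re_inner_eigen b (hl i), hCdef, coe_sum_traceClass, sum_apply, inner_sum, map_sum]
  rw [entropy_eq_tsum b hC hl0 hl]
  -- In the eigenbasis of the total `C`, each `lᵢ` is the sum of the diagonal entries of the `A k`.
  -- The entropy thus splits into terms `-Tr A k log C` (normalized by `tr C`), and each is compared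
  -- with `-Tr A k log A k`.
  have hstep : ∀ i, ENNReal.ofReal (l i * (Real.log (tr C) - Real.log (l i)))
      ≤ ∑ k ∈ s, ENNReal.ofReal (RCLike.re ⟪b i, (A k : H →L[ℂ] H) (b i)⟫_ℂ
        * (Real.log (tr C) - Real.log (l i))) := fun i => by
    rcases (hl0 i).eq_or_lt with h | h
    · simp [← h]
    · rw [← ENNReal.ofReal_sum_of_nonneg fun k hk =>
        mul_nonneg (re_inner_nonneg (hA k hk) _) (log_sub_log_nonneg h (hlC i)),
        ← Finset.sum_mul, ← hsum]
  refine (ENNReal.tsum_le_tsum hstep).trans ?_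
  rw [Summable.tsum_finsetSum fun _ _ => ENNReal.summable]
  refine Finset.sum_le_sum fun k hk => ?_
  obtain ⟨κ', c, a, h0, ha⟩ := exists_eigenbasis (hA k hk) (posTrace_ne_top _ (hA k hk))
  rw [← tsum_relEta_eq_entropy_add c (hA k hk) h0 ha (htle k hk)]
  exact tsum_mul_log_le_of_le b c (hA k hk) (hle k hk) h0 ha hl0 hl le_rfl

lemma entropy_add_le {A B : TraceClass H} (hA : 0 ≤ (A : H →L[ℂ] H)) (hB : 0 ≤ (B : H →L[ℂ] H)) :
    entropy (A + B) ≤ entropy A + entropy B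
      + ENNReal.ofReal (relEta (tr A + tr B) (tr A) + relEta (tr A + tr B) (tr B)) := by
  have h := entropy_sum_le Finset.univ (A := fun k : Bool => bif k then A else B)
    (fun k _ => by cases k <;> simp [hA, hB])
  simp only [Fintype.sum_bool, cond_true, cond_false] at h
  rw [ENNReal.ofReal_add (relEta_nonneg (tr_nonneg A) (by linarith [tr_nonneg B]))
    (relEta_nonneg (tr_nonneg B) (by linarith [tr_nonneg A]))]
  refine h.trans (le_of_eq ?_)
  ring

/-- The log sum inequality for two terms. -/
lemma relEta_add_le {s t x y : ℝ} (hx : 0 ≤ x) (hxs : x ≤ s) (hy : 0 ≤ y) (hyt : y ≤ t) :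
    relEta s x + relEta t y ≤ relEta (s + t) (x + y) := by
  rcases hx.eq_or_lt with h | h
  · rw [← h, relEta_zero, zero_add, zero_add, relEta, relEta]
    rcases hy.eq_or_lt with h' | h'
    · simp [← h']
    · have := Real.log_le_log (h'.trans_le hyt) (by linarith : t ≤ s + t)
      exact mul_le_mul_of_nonneg_left (by linarith) hy
  rcases hy.eq_or_lt with h' | h'
  · rw [← h', relEta_zero, add_zero, add_zero, relEta, relEta]
    have := Real.log_le_log (h.trans_le hxs) (by linarith : s ≤ s + t)
    exact mul_le_mul_of_nonneg_left (by linarith) hx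
  have hs := h.trans_le hxs
  have ht := h'.trans_le hyt
  have hst : 0 < s + t := by linarith
  have hxy : 0 < x + y := by linarith
  -- Take the tangents at the split of `x + y` in the ratio `s : t`; the right-hand sides then add
  -- up to zero.
  have h1 := mul_log_sub_log_le hx (show 0 < s * ((x + y) / (s + t)) by positivity)
  have h2 := mul_log_sub_log_le hy (show 0 < t * ((x + y) / (s + t)) by positivity)
  rw [Real.log_mul hs.ne' (by positivity), Real.log_div hxy.ne' hst.ne'] at h1
  rw [Real.log_mul ht.ne' (by positivity), Real.log_div hxy.ne' hst.ne'] at h2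
  have h3 : s * ((x + y) / (s + t)) + t * ((x + y) / (s + t)) = x + y := by
    field_simp
  simp only [relEta]
  nlinarith

/-- Superadditivity (concavity) of the homogeneous entropy. -/
lemma entropy_add_entropy_le {A B : TraceClass H} (hA : 0 ≤ (A : H →L[ℂ] H))
    (hB : 0 ≤ (B : H →L[ℂ] H)) : entropy A + entropy B ≤ entropy (A + B) := by
  have hC : 0 ≤ ((A + B : TraceClass H) : H →L[ℂ] H) := add_nonneg hA hB
  obtain ⟨ι, b, l, hl0, hl⟩ := exists_eigenbasis hC (posTrace_ne_top _ hC)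
  obtain ⟨κ, c, a, ha0, ha⟩ := exists_eigenbasis hA (posTrace_ne_top _ hA)
  obtain ⟨κ', c', a', ha0', ha'⟩ := exists_eigenbasis hB (posTrace_ne_top _ hB)
  rw [entropy_eq_tsum b hC hl0 hl, entropy_eq_tsum c hA ha0 ha, entropy_eq_tsum c' hB ha0' ha']
  -- Peierls' inequality moves both entropies to the eigenbasis of `A + B`, where the log-sum
  -- inequality applies to each pair of diagonal entries.
  refine (add_le_add (tsum_relEta_eigenvalue_le b c hA ha0 ha le_rfl)
    (tsum_relEta_eigenvalue_le b c' hB ha0' ha' le_rfl)).trans ?_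
  rw [← ENNReal.tsum_add]
  refine ENNReal.tsum_le_tsum fun i => ?_
  have hxA := re_inner_le_tr b hA i
  have hxB := re_inner_le_tr b hB i
  rw [← ENNReal.ofReal_add (relEta_nonneg (re_inner_nonneg hA _) hxA)
    (relEta_nonneg (re_inner_nonneg hB _) hxB)]
  refine ENNReal.ofReal_le_ofReal ?_
  have hs : l i = RCLike.re ⟪b i, (A : H →L[ℂ] H) (b i)⟫_ℂ
      + RCLike.re ⟪b i, (B : H →L[ℂ] H) (b i)⟫_ℂ := by
    rw [← re_inner_eigen b (hl i), Submodule.coe_add, add_apply, inner_add_right, map_add]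
  rw [hs, tr_add hA hB]
  exact relEta_add_le (re_inner_nonneg hA _) hxA (re_inner_nonneg hB _) hxB

/-- Homogeneity of the entropy. -/
lemma entropy_smul {r : ℝ} (hr : 0 ≤ r) (A : TraceClass H) :
    entropy ((r : ℂ) • A) = ENNReal.ofReal r * entropy A := by
  have hc : (((r : ℂ) • A : TraceClass H) : H →L[ℂ] H) = r • (A : H →L[ℂ] H) := by
    rw [Submodule.coe_smul, Complex.coe_smul]
  rw [entropy, entropy, hc, posTrace_smul hr, mul_assoc]
  rcases hr.eq_or_lt with h | h
  · simp [← h]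
  · rw [ENNReal.toReal_mul, ENNReal.toReal_ofReal hr, smul_smul, mul_inv_rev, mul_assoc,
      inv_mul_cancel₀ h.ne', mul_one]

lemma tr_smul {r : ℝ} (hr : 0 ≤ r) (A : TraceClass H) : tr ((r : ℂ) • A) = r * tr A := by
  have hc : (((r : ℂ) • A : TraceClass H) : H →L[ℂ] H) = r • (A : H →L[ℂ] H) := by
    rw [Submodule.coe_smul, Complex.coe_smul]
  rw [tr, hc, posTrace_smul hr, ENNReal.toReal_mul, ENNReal.toReal_ofReal hr, tr]

/-! ### Rank-one operators and boundedness of positive maps -/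

lemma rankOne_self_nonneg (φ : H) : 0 ≤ InnerProductSpace.rankOne ℂ φ φ := by
  rw [ContinuousLinearMap.nonneg_iff_isPositive]
  exact InnerProductSpace.isPositive_rankOne_self φ

lemma re_inner_rankOne_self (φ x : H) :
    RCLike.re ⟪x, InnerProductSpace.rankOne ℂ φ φ x⟫_ℂ = ‖⟪x, φ⟫_ℂ‖ ^ 2 := by
  rw [InnerProductSpace.rankOne_apply, inner_smul_right, ← inner_conj_symm φ x, mul_comm,
    Complex.mul_conj, Complex.normSq_eq_norm_sq]
  rfl

lemma posTrace_rankOne_self (φ : H) :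
    posTrace (InnerProductSpace.rankOne ℂ φ φ) = ENNReal.ofReal (‖φ‖ ^ 2) := by
  simp only [posTrace, re_inner_rankOne_self]
  exact parseval (basis H) φ

/-- The operator `|φ⟩⟨φ|`. -/
def ketBra (φ : H) : TraceClass H :=
  ⟨InnerProductSpace.rankOne ℂ φ φ, by
    change traceNorm _ < ∞
    rw [traceNorm_of_nonneg (rankOne_self_nonneg φ), posTrace_rankOne_self]
    exact ENNReal.ofReal_lt_top⟩

lemma coe_ketBra (φ : H) : (ketBra φ : H →L[ℂ] H) = InnerProductSpace.rankOne ℂ φ φ := rfl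

lemma ketBra_nonneg (φ : H) : 0 ≤ (ketBra φ : H →L[ℂ] H) := rankOne_self_nonneg φ

lemma tr_ketBra {φ : H} (h : ‖φ‖ = 1) : tr (ketBra φ) = 1 := by
  rw [tr, coe_ketBra, posTrace_rankOne_self, h]
  simp

lemma coe_real_smul_nonneg {r : ℝ} (hr : 0 ≤ r) {A : TraceClass H}
    (hA : 0 ≤ (A : H →L[ℂ] H)) : 0 ≤ (((r : ℂ) • A : TraceClass H) : H →L[ℂ] H) := by
  rw [Submodule.coe_smul, Complex.coe_smul]
  exact smul_nonneg hr hA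

lemma tr_mono {A B : TraceClass H} (hA : 0 ≤ (A : H →L[ℂ] H)) (h : (A : H →L[ℂ] H) ≤ B) :
    tr A ≤ tr B :=
  ENNReal.toReal_mono (posTrace_ne_top B (hA.trans h)) (posTrace_mono h)

/-- Every sequence of pure states is dominated, up to the factors `2⁻ⁿ`, by a single trace class
operator. -/
lemma exists_dominating (φ : ℕ → H) (hφ : ∀ n, ‖φ n‖ = 1) :
    ∃ S : TraceClass H, ∀ n, ((((1 / 2 : ℝ) ^ n : ℝ) : ℂ) • ketBra (φ n) : H →L[ℂ] H) ≤ S := by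
  set f : ℕ → H →L[ℂ] H := fun n => ((1 / 2 : ℝ) ^ n) • (ketBra (φ n) : H →L[ℂ] H) with hf
  have hf0 : ∀ n, 0 ≤ f n := fun n => smul_nonneg (by positivity) (ketBra_nonneg _)
  have hgeo : HasSum (fun n : ℕ => (1 / 2 : ℝ) ^ n) 2 := hasSum_geometric_two
  -- Convergence is in operator norm; trace class membership follows afterwards by exchanging sums
  -- of nonnegative terms.
  have hsum : Summable f := by
    refine Summable.of_norm_bounded hgeo.summable fun n => ?_
    rw [hf, norm_smul, coe_ketBra, InnerProductSpace.norm_rankOne, hφ, mul_one, mul_one,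
      Real.norm_of_nonneg (by positivity)]
  set S := ∑' n, f n with hS
  have hle : ∀ n, f n ≤ S := fun n => le_hasSum hsum.hasSum n fun j _ => hf0 j
  have hS0 : 0 ≤ S := (hf0 0).trans (hle 0)
  have hinner : ∀ x, HasSum (fun n => (1 / 2 : ℝ) ^ n * ‖⟪x, φ n⟫_ℂ‖ ^ 2)
      (RCLike.re ⟪x, S x⟫_ℂ) := fun x => by
    have h1 := (hsum.hasSum.mapL (ContinuousLinearMap.apply ℂ H x)).mapL (innerSL ℂ x)
    have h2 := Complex.hasSum_re h1
    refine HasSum.congr_fun h2 fun n => ?_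
    simp only [ContinuousLinearMap.apply_apply, innerSL_apply_apply, hf]
    rw [smul_apply, ← Complex.coe_smul, inner_smul_right, coe_ketBra, Complex.re_ofReal_mul,
      ← re_inner_rankOne_self]
    rfl
  have htr : posTrace S = 2 := by
    have h1 : ∀ i, ENNReal.ofReal (RCLike.re ⟪basis H i, S (basis H i)⟫_ℂ)
        = ∑' n, ENNReal.ofReal ((1 / 2 : ℝ) ^ n) * ENNReal.ofReal (‖⟪basis H i, φ n⟫_ℂ‖ ^ 2) :=
      fun i => by
        rw [← (hinner (basis H i)).tsum_eq, ENNReal.ofReal_tsum_of_nonneg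
          (fun n => by positivity) (hinner _).summable]
        exact tsum_congr fun n => ENNReal.ofReal_mul (by positivity)
    simp only [posTrace, h1]
    rw [ENNReal.tsum_comm]
    simp only [ENNReal.tsum_mul_left, parseval (basis H), hφ]
    simp only [one_pow, ENNReal.ofReal_one, mul_one]
    rw [← ENNReal.ofReal_tsum_of_nonneg (fun n => by positivity) hgeo.summable, hgeo.tsum_eq]
    simp
  refine ⟨⟨S, ?_⟩, fun n => ?_⟩
  · change traceNorm S < ∞
    rw [traceNorm_of_nonneg hS0, htr]
    exact ENNReal.ofNat_lt_top
  · rw [Complex.coe_smul]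
    exact hle n

variable {K : Type*} [NormedAddCommGroup K] [InnerProductSpace ℂ K] [CompleteSpace K]

lemma IsPositiveMap.mono {Φ : TraceClass H →ₗ[ℂ] TraceClass K} (hΦ : IsPositiveMap Φ)
    {A B : TraceClass H} (h : (A : H →L[ℂ] H) ≤ B) : (Φ A : K →L[ℂ] K) ≤ Φ B := by
  have := hΦ (B - A) (by rw [Submodule.coe_sub]; exact sub_nonneg.2 h)
  rw [map_sub, Submodule.coe_sub] at this
  exact sub_nonneg.1 this

/-- A positive map is bounded on pure states. -/
lemma IsPositiveMap.exists_tr_le {Φ : TraceClass H →ₗ[ℂ] TraceClass K} (hΦ : IsPositiveMap Φ) :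
    ∃ M : ℝ, 0 ≤ M ∧ ∀ φ : H, ‖φ‖ = 1 → tr (Φ (ketBra φ)) ≤ M := by
  by_contra! hcon
  -- If the bound fails, pick output traces above `4ⁿ`. The weights `2⁻ⁿ` leave `2ⁿ`, and positivity
  -- would force the finite trace of `Φ S` to exceed all of these.
  choose φ hφ hlt using fun n : ℕ => hcon ((4 : ℝ) ^ n) (by positivity)
  obtain ⟨S, hS⟩ := exists_dominating φ hφ
  have h : ∀ n : ℕ, (2 : ℝ) ^ n ≤ tr (Φ S) := fun n => by
    have hr : (0 : ℝ) ≤ (1 / 2) ^ n := by positivity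
    have h1 : tr (Φ ((((1 / 2 : ℝ) ^ n : ℝ) : ℂ) • ketBra (φ n))) ≤ tr (Φ S) :=
      tr_mono (hΦ _ (coe_real_smul_nonneg hr (ketBra_nonneg _))) (hΦ.mono (hS n))
    rw [map_smul, tr_smul hr] at h1
    refine le_trans ?_ h1
    calc (2 : ℝ) ^ n = (1 / 2) ^ n * 4 ^ n := by rw [← mul_pow]; norm_num
      _ ≤ _ := mul_le_mul_of_nonneg_left (hlt n).le hr
  obtain ⟨n, hn⟩ := pow_unbounded_of_one_lt (tr (Φ S)) (one_lt_two (α := ℝ))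
  exact absurd (h n) (not_le.2 hn)

/-! ### Outputs of finite-rank operators -/

/-- The entropy of a finite family is at most the logarithm of its size. -/
lemma sum_relEta_le {κ : Type*} (s : Finset κ) {m : κ → ℝ} (hm : ∀ k ∈ s, 0 ≤ m k) :
    ∑ k ∈ s, relEta (∑ j ∈ s, m j) (m k) ≤ (∑ j ∈ s, m j) * Real.log s.card := by
  set t := ∑ j ∈ s, m j with ht
  rcases (Finset.sum_nonneg hm).eq_or_lt with h | h
  · have h0 := (Finset.sum_eq_zero_iff_of_nonneg hm).1 h.symm
    rw [ht, ← h, zero_mul]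
    exact (Finset.sum_eq_zero fun k hk => by rw [h0 k hk, relEta_zero]).le
  · rw [← ht] at h
    have hs : s.Nonempty := by
      rw [Finset.nonempty_iff_ne_empty]; rintro rfl; simp [ht] at h
    have hc : (0 : ℝ) < s.card := by exact_mod_cast hs.card_pos
    -- Compare with the uniform distribution `t / s.card`.
    have h1 : ∀ k ∈ s, relEta t (m k) ≤ m k * Real.log s.card + (t / s.card - m k) :=
      fun k hk => by
        have := mul_log_sub_log_le (hm k hk) (div_pos h hc)
        rw [Real.log_div h.ne' hc.ne'] at this
        rw [relEta]; linarith
    refine (Finset.sum_le_sum h1).trans (le_of_eq ?_)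
    rw [Finset.sum_add_distrib, Finset.sum_sub_distrib, Finset.sum_const, nsmul_eq_mul,
      mul_div_cancel₀ _ hc.ne', ← Finset.sum_mul, ← ht, sub_self, add_zero]

/-- A positive operator with finitely many nonzero eigenvalues. -/
lemma eq_sum_ketBra {ι : Type*} (b : HilbertBasis ι ℂ H) {A : TraceClass H} {l : ι → ℝ}
    (hl : ∀ i, (A : H →L[ℂ] H) (b i) = (l i : ℂ) • b i) {s : Finset ι}
    (hs : ∀ i ∉ s, l i = 0) : A = ∑ i ∈ s, (l i : ℂ) • ketBra (b i) := by
  ext x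
  have h1 := (b.hasSum_repr x).mapL (A : H →L[ℂ] H)
  have h2 : ∀ i, (A : H →L[ℂ] H) (b.repr x i • b i) = (l i : ℂ) • (⟪b i, x⟫_ℂ • b i) := fun i => by
    rw [map_smul, hl, HilbertBasis.repr_apply_apply, smul_comm]
  simp only [h2] at h1
  rw [h1.unique (hasSum_sum_of_ne_finset_zero fun i hi => by rw [hs i hi]; simp),
    coe_sum_traceClass, sum_apply]
  rfl

lemma tr_sum_ketBra {ι : Type*} (b : HilbertBasis ι ℂ H) {A : TraceClass H} {l : ι → ℝ}
    (h0 : ∀ i, 0 ≤ l i) (hl : ∀ i, (A : H →L[ℂ] H) (b i) = (l i : ℂ) • b i) {s : Finset ι}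
    (hs : ∀ i ∉ s, l i = 0) : tr A = ∑ i ∈ s, l i := by
  rw [eq_sum_ketBra b hl hs,
    tr_sum s fun i _ => coe_real_smul_nonneg (h0 i) (ketBra_nonneg _)]
  exact Finset.sum_congr rfl fun i _ => by
    rw [tr_smul (h0 i), tr_ketBra (b.orthonormal.1 i), mul_one]

/-- A finite-rank positive operator is a finite positive combination of pure states, so the bound
extends by linearity with no continuity of `Φ`. -/
lemma tr_map_le {Φ : TraceClass H →ₗ[ℂ] TraceClass K} (hΦ : IsPositiveMap Φ) {M : ℝ}
    (hM : ∀ φ : H, ‖φ‖ = 1 → tr (Φ (ketBra φ)) ≤ M)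
    {ι : Type*} (b : HilbertBasis ι ℂ H) {A : TraceClass H} {l : ι → ℝ}
    (h0 : ∀ i, 0 ≤ l i) (hl : ∀ i, (A : H →L[ℂ] H) (b i) = (l i : ℂ) • b i) {s : Finset ι}
    (hs : ∀ i ∉ s, l i = 0) : tr (Φ A) ≤ M * tr A := by
  rw [tr_sum_ketBra b h0 hl hs, eq_sum_ketBra b hl hs, map_sum,
    tr_sum s fun i _ => hΦ _ (coe_real_smul_nonneg (h0 i) (ketBra_nonneg _)), Finset.mul_sum]
  refine Finset.sum_le_sum fun i _ => ?_
  rw [map_smul, tr_smul (h0 i), mul_comm]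
  exact mul_le_mul_of_nonneg_right (hM _ (b.orthonormal.1 i)) (h0 i)

/-- The output entropy of a finite rank operator. -/
lemma entropy_map_le {Φ : TraceClass H →ₗ[ℂ] TraceClass K} (hΦ : IsPositiveMap Φ) {M : ℝ}
    (hM : ∀ φ : H, ‖φ‖ = 1 → tr (Φ (ketBra φ)) ≤ M) {C : ℝ≥0}
    (hC : ∀ φ : H, ‖φ‖ = 1 → entropy (Φ (ketBra φ)) ≤ C)
    {ι : Type*} (b : HilbertBasis ι ℂ H) {A : TraceClass H} {l : ι → ℝ}
    (h0 : ∀ i, 0 ≤ l i) (hl : ∀ i, (A : H →L[ℂ] H) (b i) = (l i : ℂ) • b i) {s : Finset ι}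
    (hs : ∀ i ∉ s, l i = 0) :
    entropy (Φ A) ≤ ENNReal.ofReal (tr A * (C + M * Real.log s.card)) := by
  have hpos : ∀ i ∈ s, 0 ≤ (Φ ((l i : ℂ) • ketBra (b i)) : K →L[ℂ] K) := fun i _ =>
    hΦ _ (coe_real_smul_nonneg (h0 i) (ketBra_nonneg _))
  have htA := tr_sum_ketBra b h0 hl hs
  have htΦ := tr_map_le hΦ hM b h0 hl hs
  have hΦA : Φ A = ∑ i ∈ s, Φ ((l i : ℂ) • ketBra (b i)) := by
    rw [← map_sum, ← eq_sum_ketBra b hl hs]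
  have htΦA : tr (Φ A) = ∑ i ∈ s, tr (Φ ((l i : ℂ) • ketBra (b i))) := by
    rw [hΦA, tr_sum s hpos]
  -- Over the spectral decomposition, the pure outputs contribute at most `tr A * C`, and the
  -- classical entropy of the output traces at most `tr (Φ A) * log s.card`.
  have hent := entropy_sum_le s hpos
  rw [← hΦA, ← htΦA, Finset.sum_add_distrib] at hent
  have h1 : ∑ i ∈ s, entropy (Φ ((l i : ℂ) • ketBra (b i))) ≤ ENNReal.ofReal (tr A * C) := by
    rw [htA, Finset.sum_mul, ENNReal.ofReal_sum_of_nonneg fun i _ => mul_nonneg (h0 i) C.coe_nonneg]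
    refine Finset.sum_le_sum fun i _ => ?_
    rw [map_smul, entropy_smul (h0 i), ENNReal.ofReal_mul (h0 i), ENNReal.ofReal_coe_nnreal]
    gcongr
    exact hC _ (b.orthonormal.1 i)
  have hlog : 0 ≤ Real.log s.card := Real.log_natCast_nonneg _
  have h2 : ∑ i ∈ s, ENNReal.ofReal (relEta (tr (Φ A)) (tr (Φ ((l i : ℂ) • ketBra (b i)))))
      ≤ ENNReal.ofReal (tr A * (M * Real.log s.card)) := by
    rw [← ENNReal.ofReal_sum_of_nonneg fun i hi => relEta_nonneg (tr_nonneg _) (by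
      rw [htΦA]; exact Finset.single_le_sum
        (f := fun i => tr (Φ ((l i : ℂ) • ketBra (b i)))) (fun j _ => tr_nonneg _) hi), htΦA]
    refine ENNReal.ofReal_le_ofReal ((sum_relEta_le s fun i _ => tr_nonneg _).trans ?_)
    rw [← htΦA]
    nlinarith
  refine hent.trans ((add_le_add h1 h2).trans ?_)
  -- Nonnegativity of `M` is not assumed; it is read off from an eigenvector when there is one, and
  -- otherwise `tr A = 0`.
  rcases s.eq_empty_or_nonempty with rfl | ⟨i, hi⟩
  · simp [htA]
  · have hM0 : 0 ≤ M := (tr_nonneg _).trans (hM _ (b.orthonormal.1 i))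
    rw [← ENNReal.ofReal_add (mul_nonneg (tr_nonneg A) C.coe_nonneg)
      (mul_nonneg (tr_nonneg A) (mul_nonneg hM0 hlog)), mul_add]

/-! ### Rank counting and the Jordan decomposition -/

/-- The number of nonzero eigenvalues is at most the rank of any operator that is injective on the
span of the corresponding eigenvectors. -/
lemma exists_finset_of_rank_le.{u} {H : Type u} [NormedAddCommGroup H] [InnerProductSpace ℂ H]
    [CompleteSpace H] {ι : Type u} (b : HilbertBasis ι ℂ H) (l : ι → ℝ) {R : H →L[ℂ] H} {n : ℕ}
    (hR : LinearMap.rank (R : H →ₗ[ℂ] H) ≤ n)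
    (hinj : ∀ x ∈ Submodule.span ℂ (b '' {i | l i ≠ 0}), R x = 0 → x = 0) :
    ∃ s : Finset ι, s.card ≤ n ∧ ∀ i ∉ s, l i = 0 := by
  set v : {i | l i ≠ 0} → H := fun i => b i with hv
  have hrange : Set.range v = b '' {i | l i ≠ 0} := by
    ext x; simp [hv]
  have hli : LinearIndependent ℂ v :=
    b.orthonormal.linearIndependent.comp _ Subtype.val_injective
  have hli2 : LinearIndependent ℂ ((R : H →ₗ[ℂ] H) ∘ v) := by
    refine hli.map_injOn _ ?_
    rw [hrange]
    intro x hx y hy hxy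
    refine sub_eq_zero.1 (hinj _ (sub_mem hx hy) ?_)
    rw [map_sub]
    exact sub_eq_zero.2 hxy
  have hcard : Cardinal.mk {i | l i ≠ 0} ≤ n := by
    rw [← Cardinal.mk_range_eq _ hli2.injective, ← rank_span hli2]
    refine (Submodule.rank_mono ?_).trans hR
    rw [Submodule.span_le]
    rintro _ ⟨i, rfl⟩
    exact ⟨v i, rfl⟩
  have hfin : Finite {i | l i ≠ 0} :=
    Cardinal.lt_aleph0_iff_finite.1 (hcard.trans_lt (Cardinal.natCast_lt_aleph0))
  have hfs : Set.Finite {i | l i ≠ 0} := hfin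
  refine ⟨hfs.toFinset, ?_, fun i hi => ?_⟩
  · have : Cardinal.mk {i | l i ≠ 0} = hfs.toFinset.card := by
      rw [← Cardinal.mk_coe_finset]
      exact Cardinal.mk_congr (Equiv.subtypeEquivRight fun i => hfs.mem_toFinset.symm)
    rw [this] at hcard
    exact_mod_cast hcard
  · simpa using hi

/-- If `ρ + N = σ + P` with orthogonal positive `P`, `N`, then `P` has at most as many nonzero
eigenvalues as the rank of `ρ`. -/
lemma exists_finset_of_orthogonal.{u} {H : Type u} [NormedAddCommGroup H]
    [InnerProductSpace ℂ H] [CompleteSpace H] {ι : Type u} (b : HilbertBasis ι ℂ H)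
    {ρ σ P N : H →L[ℂ] H} (hσ : 0 ≤ σ) (hP : 0 ≤ P) (h : ρ + N = σ + P) (hNP : N * P = 0)
    {l : ι → ℝ} (hl0 : ∀ i, 0 ≤ l i) (hl : ∀ i, P (b i) = (l i : ℂ) • b i) {n : ℕ}
    (hρ : LinearMap.rank (ρ : H →ₗ[ℂ] H) ≤ n) :
    ∃ s : Finset ι, s.card ≤ n ∧ ∀ i ∉ s, l i = 0 := by
  -- `ρ` is injective on the span of the eigenvectors of `P` with nonzero eigenvalue. There `N x =
  -- 0`, so `ρ x = 0` gives `σ x + P x = 0`; positivity kills `⟨x, P x⟩`, hence every coefficient of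
  -- `x`.
  refine exists_finset_of_rank_le b l hρ fun x hx hρx => ?_
  have hN : N x = 0 := by
    have hle : Submodule.span ℂ (b '' {i | l i ≠ 0}) ≤ LinearMap.ker (N : H →ₗ[ℂ] H) := by
      rw [Submodule.span_le]
      rintro _ ⟨i, hi, rfl⟩
      have h1 : N (P (b i)) = 0 := by rw [← mul_apply_eq_comp, hNP]; rfl
      rw [hl, map_smul] at h1
      exact (smul_eq_zero.1 h1).resolve_left (Complex.ofReal_ne_zero.2 hi)
    exact hle hx
  have hP0 : RCLike.re ⟪x, P x⟫_ℂ = 0 := by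
    have h1 : σ x + P x = 0 := by
      rw [← add_apply, ← h, add_apply, hρx, hN, add_zero]
    have h2 : RCLike.re ⟪x, σ x⟫_ℂ + RCLike.re ⟪x, P x⟫_ℂ = 0 := by
      rw [← map_add, ← inner_add_right, h1]; simp
    linarith [re_inner_nonneg hσ x, re_inner_nonneg hP x]
  have h3 := (hasSum_zero_iff_of_nonneg fun i => mul_nonneg (hl0 i) (sq_nonneg _)).1
    (hP0 ▸ hasSum_eigenvalue_mul b hP.isSelfAdjoint hl x)
  have h4 : ∀ i, ⟪b i, x⟫_ℂ = 0 := fun i => by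
    by_cases hi : l i = 0
    · have hle : Submodule.span ℂ (b '' {i | l i ≠ 0}) ≤ (ℂ ∙ b i)ᗮ := by
        rw [Submodule.span_le]
        rintro _ ⟨j, hj, rfl⟩
        refine Submodule.mem_orthogonal_singleton_iff_inner_right.2
          (b.orthonormal.2 fun hij => hj (hij ▸ hi))
      exact Submodule.mem_orthogonal_singleton_iff_inner_right.1 (hle hx)
    · have := congrFun h3 i
      simpa [hi] using this
  have h5 := hasSum_norm_inner_sq b x
  simp only [h4, norm_zero, ne_eq, OfNat.ofNat_ne_zero, not_false_eq_true, zero_pow] at h5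
  simpa using h5.unique hasSum_zero

/-- The Jordan decomposition of the difference of two operators of equal trace. -/
lemma exists_jordan {ρ σ : TraceClass H} (hρ : 0 ≤ (ρ : H →L[ℂ] H)) (hσ : 0 ≤ (σ : H →L[ℂ] H))
    (ht : tr ρ = tr σ) : ∃ P N : TraceClass H, 0 ≤ (P : H →L[ℂ] H) ∧ 0 ≤ (N : H →L[ℂ] H) ∧
      ρ + N = σ + P ∧ tr P = traceDist ρ σ ∧
      (N : H →L[ℂ] H) * (P : H →L[ℂ] H) = 0 := by
  set D : H →L[ℂ] H := ((ρ - σ : TraceClass H) : H →L[ℂ] H) with hD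
  have hDs : IsSelfAdjoint D := by
    rw [hD, Submodule.coe_sub]; exact hρ.isSelfAdjoint.sub hσ.isSelfAdjoint
  have hP : 0 ≤ D⁺ := CFC.posPart_nonneg D
  have hN : 0 ≤ D⁻ := CFC.negPart_nonneg D
  have habs : D⁺ + D⁻ = CFC.abs D := CFC.posPart_add_negPart D hDs
  have hfin : posTrace D⁺ + posTrace D⁻ = traceNorm D := by
    rw [← posTrace_add hP hN, habs, traceNorm]
  have hlt : posTrace D⁺ + posTrace D⁻ < ∞ := hfin ▸ (ρ - σ).2
  obtain ⟨hP', hN'⟩ := ENNReal.add_lt_top.1 hlt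
  let P : TraceClass H := ⟨D⁺, by change traceNorm _ < ∞; rwa [traceNorm_of_nonneg hP]⟩
  let N : TraceClass H := ⟨D⁻, by change traceNorm _ < ∞; rwa [traceNorm_of_nonneg hN]⟩
  have heq : ρ + N = σ + P := by
    have h1 : D⁺ - D⁻ = D := CFC.posPart_sub_negPart D hDs
    rw [hD, Submodule.coe_sub] at h1
    apply Subtype.ext
    change (ρ : H →L[ℂ] H) + D⁻ = σ + D⁺
    rw [add_comm (σ : H →L[ℂ] H), ← sub_eq_sub_iff_add_eq_add, hD, Submodule.coe_sub, h1]
  have h1 : tr P + tr N = 2 * traceDist ρ σ := by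
    rw [traceDist, ← hD, ← hfin, ENNReal.toReal_add hP'.ne hN'.ne]
    change (posTrace D⁺).toReal + (posTrace D⁻).toReal = _
    ring
  -- Equal traces of `ρ` and `σ` give `tr P = tr N`, so each is half the trace norm.
  have h2 : tr ρ + tr N = tr σ + tr P := by rw [← tr_add hρ hN, heq, tr_add hσ hP]
  exact ⟨P, N, hP, hN, heq, by linarith, CFC.negPart_mul_posPart D⟩

/-! ### The continuity estimate -/

/-- The entropy of two weights, bounded through a larger pair of weights. -/
lemma relEta_pair_le {x y M ε : ℝ} (hx : 0 ≤ x) (hxM : x ≤ M) (hy : 0 ≤ y) (hyM : y ≤ M * ε)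
    (hε : 0 ≤ ε) :
    relEta (x + y) x + relEta (x + y) y ≤ M * ((1 + ε) * Real.binEntropy (ε / (1 + ε))) := by
  rcases hε.eq_or_lt with h | h
  · have : y = 0 := le_antisymm (by rw [← h, mul_zero] at hyM; exact hyM) hy
    simp [this, ← h, relEta]
  rcases (add_nonneg hx hy).eq_or_lt with h' | h'
  · have h1 : x = 0 := by linarith
    have h2 : y = 0 := by linarith
    rw [h1, h2, add_zero, relEta_zero, add_zero]
    exact mul_nonneg (hx.trans hxM) (mul_nonneg (by linarith) (Real.binEntropy_nonneg
      (by positivity) ((div_le_one (by linarith)).2 (by linarith))))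
  have hp : (0 : ℝ) < 1 + ε := by linarith
  -- Tangents at the split of `x + y` in the ratio `1 : ε` give the bound `x log (1 + ε) + y log ((1
  -- + ε) / ε)`. It is nondecreasing in `x` and `y`, so they can be replaced by `M` and `M ε`.
  have h1 := mul_log_sub_log_le hx (div_pos h' hp)
  have h2 := mul_log_sub_log_le hy (div_pos (mul_pos h' h) hp)
  rw [Real.log_div h'.ne' hp.ne'] at h1
  rw [Real.log_div (mul_pos h' h).ne' hp.ne', Real.log_mul h'.ne' h.ne'] at h2
  have h3 : (x + y) / (1 + ε) + (x + y) * ε / (1 + ε) = x + y := by field_simp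
  have e1 : 1 - ε / (1 + ε) = 1 / (1 + ε) := by field_simp; ring
  have e2 : (1 + ε) * Real.binEntropy (ε / (1 + ε))
      = ε * (Real.log (1 + ε) - Real.log ε) + Real.log (1 + ε) := by
    rw [Real.binEntropy, e1, inv_div, inv_div, div_one, Real.log_div hp.ne' h.ne']
    field_simp
  have l1 : 0 ≤ Real.log (1 + ε) := Real.log_nonneg (by linarith)
  have l2 : 0 ≤ Real.log (1 + ε) - Real.log ε := log_sub_log_nonneg h (by linarith)
  have m1 := mul_le_mul_of_nonneg_right hxM l1
  have m2 := mul_le_mul_of_nonneg_right hyM l2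
  rw [e2, relEta, relEta]
  nlinarith

/-- The one-sided continuity bound for the output entropy. -/
lemma entropy_map_le_entropy_map_add.{u} {H : Type u} [NormedAddCommGroup H]
    [InnerProductSpace ℂ H] [CompleteSpace H]
    {Φ : TraceClass H →ₗ[ℂ] TraceClass K} (hΦ : IsPositiveMap Φ) {M : ℝ} (hM0 : 0 ≤ M)
    (hM : ∀ φ : H, ‖φ‖ = 1 → tr (Φ (ketBra φ)) ≤ M) {C : ℝ≥0}
    (hC : ∀ φ : H, ‖φ‖ = 1 → entropy (Φ (ketBra φ)) ≤ C) {ρ σ : TraceClass H}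
    (hρ : IsState ρ) (hσ : IsState σ) {n : ℕ} (hn : opRank ρ ≤ n) (hσM : tr (Φ σ) ≤ M) :
    entropy (Φ ρ) ≤ entropy (Φ σ) + ENNReal.ofReal (traceDist ρ σ * (C + M * Real.log n)
      + M * ((1 + traceDist ρ σ) * Real.binEntropy (traceDist ρ σ / (1 + traceDist ρ σ)))) := by
  have htρ : tr ρ = 1 := by rw [tr, hρ.2]; rfl
  have htσ : tr σ = 1 := by rw [tr, hσ.2]; rfl
  obtain ⟨P, N, hP, hN, heq, htP, hNP⟩ := exists_jordan hρ.1 hσ.1 (htρ.trans htσ.symm)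
  obtain ⟨ι, b, l, hl0, hl⟩ := exists_eigenbasis hP (posTrace_ne_top P hP)
  have hcoe : (ρ : H →L[ℂ] H) + N = σ + P := congrArg Subtype.val heq
  obtain ⟨s, hs, hs0⟩ := exists_finset_of_orthogonal b hσ.1 hP hcoe hNP hl0 hl hn
  set ε := traceDist ρ σ with hε
  have hε0 : 0 ≤ ε := htP ▸ tr_nonneg P
  have h1 := entropy_map_le hΦ hM hC b hl0 hl hs0
  have h2 := tr_map_le hΦ hM b hl0 hl hs0
  rw [htP] at h1 h2
  have hlog : Real.log s.card ≤ Real.log n := by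
    rcases s.card.eq_zero_or_pos with h | h
    · rw [h, Nat.cast_zero, Real.log_zero]; exact Real.log_natCast_nonneg n
    · exact Real.log_le_log (by exact_mod_cast h) (by exact_mod_cast hs)
  have h1' : ε * (C + M * Real.log s.card) ≤ ε * (C + M * Real.log n) := by gcongr
  have h3 := relEta_pair_le (tr_nonneg (Φ σ)) hσM (tr_nonneg (Φ P)) h2 hε0
  have h4 : 0 ≤ ε * (C + M * Real.log n) :=
    mul_nonneg hε0 (add_nonneg C.coe_nonneg (mul_nonneg hM0 (Real.log_natCast_nonneg n)))
  have h5 : 0 ≤ M * ((1 + ε) * Real.binEntropy (ε / (1 + ε))) :=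
    mul_nonneg hM0 (mul_nonneg (by linarith) (Real.binEntropy_nonneg
      (by positivity) ((div_le_one (by linarith)).2 (by linarith))))
  -- `Φ N` only needs nonnegative entropy: superadditivity absorbs it, and no estimate on it is
  -- used.
  calc entropy (Φ ρ) ≤ entropy (Φ ρ) + entropy (Φ N) := le_self_add
    _ ≤ entropy (Φ ρ + Φ N) := entropy_add_entropy_le (hΦ _ hρ.1) (hΦ _ hN)
    _ = entropy (Φ σ + Φ P) := by rw [← map_add, heq, map_add]
    _ ≤ entropy (Φ σ) + entropy (Φ P) + ENNReal.ofReal _ :=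
      entropy_add_le (hΦ _ hσ.1) (hΦ _ hP)
    _ ≤ _ := by
      rw [add_assoc, ENNReal.ofReal_add h4 h5]
      gcongr
      exact h1.trans (ENNReal.ofReal_le_ofReal h1')

lemma traceDist_comm (ρ σ : TraceClass H) : traceDist ρ σ = traceDist σ ρ := by
  have : ((ρ - σ : TraceClass H) : H →L[ℂ] H) = -((σ - ρ : TraceClass H) : H →L[ℂ] H) := by simp
  rw [traceDist, traceDist, this, traceNorm, CFC.abs_neg, traceNorm]

/-- The output of a finite rank state has bounded trace and finite entropy. -/
lemma tr_map_le_and_entropy_map_lt_top {Φ : TraceClass H →ₗ[ℂ] TraceClass K}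
    (hΦ : IsPositiveMap Φ) {M : ℝ} (hM : ∀ φ : H, ‖φ‖ = 1 → tr (Φ (ketBra φ)) ≤ M) {C : ℝ≥0}
    (hC : ∀ φ : H, ‖φ‖ = 1 → entropy (Φ (ketBra φ)) ≤ C) {ρ : TraceClass H}
    (hρ : IsState ρ) {n : ℕ} (hn : opRank ρ ≤ n) : tr (Φ ρ) ≤ M ∧ entropy (Φ ρ) < ∞ := by
  have htρ : tr ρ = 1 := by rw [tr, hρ.2]; rfl
  obtain ⟨ι, b, l, hl0, hl⟩ := exists_eigenbasis hρ.1 (posTrace_ne_top ρ hρ.1)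
  -- The degenerate case `P = ρ`, `σ = N = 0` says that a state of rank at most `n` has at most `n`
  -- nonzero eigenvalues.
  obtain ⟨s, hs, hs0⟩ := exists_finset_of_orthogonal b (σ := 0) (N := 0) le_rfl hρ.1
    (by rw [zero_add, add_zero]) (zero_mul _) hl0 hl hn
  refine ⟨?_, (entropy_map_le hΦ hM hC b hl0 hl hs0).trans_lt ENNReal.ofReal_lt_top⟩
  have := tr_map_le hΦ hM b hl0 hl hs0
  rwa [htρ, mul_one] at this

/-- The continuity bound for the output entropy of finite rank states. -/
lemma abs_entropy_map_sub_le {Φ : TraceClass H →ₗ[ℂ] TraceClass K}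
    (hΦ : IsPositiveMap Φ) {M : ℝ} (hM0 : 0 ≤ M)
    (hM : ∀ φ : H, ‖φ‖ = 1 → tr (Φ (ketBra φ)) ≤ M) {C : ℝ≥0}
    (hC : ∀ φ : H, ‖φ‖ = 1 → entropy (Φ (ketBra φ)) ≤ C) {ρ σ : TraceClass H}
    (hρ : IsState ρ) (hσ : IsState σ) {n m : ℕ} (hn : opRank ρ ≤ n) (hm : opRank σ ≤ m)
    {L : ℝ} (hnL : Real.log n ≤ L) (hmL : Real.log m ≤ L) :
    |(entropy (Φ ρ)).toReal - (entropy (Φ σ)).toReal| ≤ traceDist ρ σ * (C + M * L)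
      + M * ((1 + traceDist ρ σ) * Real.binEntropy (traceDist ρ σ / (1 + traceDist ρ σ))) := by
  obtain ⟨htρ, hfρ⟩ := tr_map_le_and_entropy_map_lt_top hΦ hM hC hρ hn
  obtain ⟨htσ, hfσ⟩ := tr_map_le_and_entropy_map_lt_top hΦ hM hC hσ hm
  have h1 := entropy_map_le_entropy_map_add hΦ hM0 hM hC hρ hσ hn htσ
  have h2 := entropy_map_le_entropy_map_add hΦ hM0 hM hC hσ hρ hm htρ
  rw [traceDist_comm σ ρ] at h2
  set ε := traceDist ρ σ with hε
  have hε0 : 0 ≤ ε := div_nonneg ENNReal.toReal_nonneg two_pos.le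
  set B := M * ((1 + ε) * Real.binEntropy (ε / (1 + ε))) with hB
  have hB0 : 0 ≤ B :=
    mul_nonneg hM0 (mul_nonneg (by linarith) (Real.binEntropy_nonneg
      (by positivity) ((div_le_one (by linarith)).2 (by linarith))))
  -- Finiteness of the entropies allows passing to real numbers, and replacing both logarithms by
  -- `L` makes the two one-sided bounds agree.
  have key : ∀ {x y : ℝ≥0∞} {k : ℕ}, y ≠ ∞ → Real.log k ≤ L →
      x ≤ y + ENNReal.ofReal (ε * (C + M * Real.log k) + B) →
      x.toReal ≤ y.toReal + (ε * (C + M * L) + B) := fun {x y k} hy hk h => by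
    have hnn : 0 ≤ ε * (C + M * Real.log k) + B := add_nonneg
      (mul_nonneg hε0 (add_nonneg C.coe_nonneg (mul_nonneg hM0 (Real.log_natCast_nonneg k)))) hB0
    have h3 := ENNReal.toReal_mono (ENNReal.add_ne_top.2 ⟨hy, ENNReal.ofReal_ne_top⟩) h
    rw [ENNReal.toReal_add hy ENNReal.ofReal_ne_top, ENNReal.toReal_ofReal hnn] at h3
    have : ε * (C + M * Real.log k) ≤ ε * (C + M * L) := by gcongr
    linarith
  have k1 := key hfσ.ne hnL h1
  have k2 := key hfρ.ne hmL h2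
  rw [abs_le]
  constructor <;> linarith

/-- Unit trace excludes the zero operator, and finiteness excludes the default value `0` of `toNat`
at infinite cardinals. This is what makes each rank at most the sum of both minus one. -/
lemma one_le_toNat_opRank {ρ : TraceClass H} (hρ : IsState ρ)
    (hr : opRank ρ < Cardinal.aleph0) : 1 ≤ (opRank ρ).toNat := by
  rw [Nat.one_le_iff_ne_zero, Ne, Cardinal.toNat_eq_zero, not_or, not_le]
  refine ⟨fun h => ?_, hr⟩
  have h0 : (ρ : H →L[ℂ] H) = 0 := by
    rw [opRank, LinearMap.rank, Submodule.rank_eq_zero, LinearMap.range_eq_bot] at h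
    exact ContinuousLinearMap.coe_inj.1 h
  have := hρ.2
  rw [h0] at this
  simp [posTrace] at this

end OutputEntropy

end

/-! ### Uniform continuity and the explicit bound -/

theorem corollary1
    {HA : Type*} [NormedAddCommGroup HA] [InnerProductSpace ℂ HA] [CompleteSpace HA]
    [TopologicalSpace.SeparableSpace HA]
    {HB : Type*} [NormedAddCommGroup HB] [InnerProductSpace ℂ HB] [CompleteSpace HB]
    [TopologicalSpace.SeparableSpace HB]
    (Φ : OutputEntropy.TraceClass HA →ₗ[ℂ] OutputEntropy.TraceClass HB)
    (hΦ : OutputEntropy.IsPositiveMap Φ)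
    (C : ℝ≥0)
    (hC : ∀ ρ : OutputEntropy.TraceClass HA, OutputEntropy.IsPure ρ →
      OutputEntropy.outputEntropy Φ ρ ≤ C) :
    (∀ k : ℕ,
      (∀ ρ ∈ OutputEntropy.statesOfRankLE HA k, OutputEntropy.outputEntropy Φ ρ < ∞) ∧
      ∀ e : ℝ, 0 < e → ∃ d : ℝ, 0 < d ∧
        ∀ ρ ∈ OutputEntropy.statesOfRankLE HA k, ∀ σ ∈ OutputEntropy.statesOfRankLE HA k,
          2 * OutputEntropy.traceDist ρ σ < d →
          |(OutputEntropy.outputEntropy Φ ρ).toReal - (OutputEntropy.outputEntropy Φ σ).toReal|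
            < e) ∧
    (OutputEntropy.IsTraceNonincreasing Φ →
      ∀ ρ σ : OutputEntropy.TraceClass HA,
        OutputEntropy.IsState ρ → OutputEntropy.IsState σ →
        OutputEntropy.opRank ρ < Cardinal.aleph0 → OutputEntropy.opRank σ < Cardinal.aleph0 →
        |(OutputEntropy.outputEntropy Φ ρ).toReal - (OutputEntropy.outputEntropy Φ σ).toReal| ≤
          OutputEntropy.traceDist ρ σ *
              (C + Real.log ((OutputEntropy.opRank ρ).toNat + (OutputEntropy.opRank σ).toNat - 1))
            + (1 + OutputEntropy.traceDist ρ σ) *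
              Real.binEntropy
                (OutputEntropy.traceDist ρ σ / (1 + OutputEntropy.traceDist ρ σ))) := by
  have hC' : ∀ φ : HA, ‖φ‖ = 1 →
      OutputEntropy.entropy (Φ (OutputEntropy.ketBra φ)) ≤ C := fun φ hφ =>
    hC (OutputEntropy.ketBra φ) ⟨φ, hφ, rfl⟩
  refine ⟨fun k => ?_, fun htr ρ σ hρ hσ hrρ hrσ => ?_⟩
  · obtain ⟨M, hM0, hM⟩ := hΦ.exists_tr_le
    refine ⟨fun ρ hρ =>
      (OutputEntropy.tr_map_le_and_entropy_map_lt_top hΦ hM hC' hρ.1 hρ.2).2, fun e he => ?_⟩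
    -- The modulus of continuity depends on the states only through `ε`, so continuity of `f` at `0`
    -- yields uniform continuity.
    set f : ℝ → ℝ := fun ε => ε * (C + M * Real.log k)
      + M * ((1 + ε) * Real.binEntropy (ε / (1 + ε))) with hf
    have hcont : ContinuousAt f 0 := by
      have h1 : ContinuousAt (fun ε : ℝ => ε / (1 + ε)) 0 :=
        continuousAt_id.div (by fun_prop) (by norm_num)
      have h2 : ContinuousAt (fun ε : ℝ => Real.binEntropy (ε / (1 + ε))) 0 :=
        Real.binEntropy_continuous.continuousAt.comp h1
      fun_prop
    have hf0 : f 0 = 0 := by simp [hf]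
    obtain ⟨d, hd, hfd⟩ := Metric.continuousAt_iff.1 hcont e he
    -- The factor two converts the half trace norm `ε` into the trace norm.
    refine ⟨2 * d, by positivity, fun ρ hρ σ hσ hlt => ?_⟩
    refine (OutputEntropy.abs_entropy_map_sub_le hΦ hM0 hM hC' hρ.1 hσ.1 hρ.2 hσ.2
      le_rfl le_rfl).trans_lt ?_
    have h0 : 0 ≤ OutputEntropy.traceDist ρ σ := div_nonneg ENNReal.toReal_nonneg two_pos.le
    have h1 := hfd (x := OutputEntropy.traceDist ρ σ) (by
      rw [Real.dist_eq, sub_zero, abs_of_nonneg h0]; linarith)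
    rw [hf0, Real.dist_eq, sub_zero] at h1
    exact (le_abs_self _).trans_lt h1
  · have hM : ∀ φ : HA, ‖φ‖ = 1 →
        OutputEntropy.tr (Φ (OutputEntropy.ketBra φ)) ≤ 1 := fun φ hφ => by
      rw [← OutputEntropy.tr_ketBra hφ]
      exact ENNReal.toReal_mono (OutputEntropy.posTrace_ne_top _ (OutputEntropy.ketBra_nonneg φ))
        (htr _ (OutputEntropy.ketBra_nonneg φ))
    have h1ρ := OutputEntropy.one_le_toNat_opRank hρ hrρ
    have h1σ := OutputEntropy.one_le_toNat_opRank hσ hrσ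
    have c1ρ : (1 : ℝ) ≤ (OutputEntropy.opRank ρ).toNat := by exact_mod_cast h1ρ
    have c1σ : (1 : ℝ) ≤ (OutputEntropy.opRank σ).toNat := by exact_mod_cast h1σ
    have h := OutputEntropy.abs_entropy_map_sub_le hΦ zero_le_one hM hC' hρ hσ
      (Cardinal.cast_toNat_of_lt_aleph0 hrρ).ge (Cardinal.cast_toNat_of_lt_aleph0 hrσ).ge
      (L := Real.log ((OutputEntropy.opRank ρ).toNat + (OutputEntropy.opRank σ).toNat - 1))
      -- Each rank is at most the sum of both minus one because the other rank is at least one.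
      (Real.log_le_log (by linarith) (by linarith)) (Real.log_le_log (by linarith) (by linarith))
    rwa [one_mul, one_mul] at h
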